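/- **Conventions.** For a finite poset $P$ with minimum $\hat 0$, all of whose intervals $[\hat 0,t]$ are Eulerian, let $\rho(t)$ be the length of a maximal chain of $[\hat 0,t]$ and $n$ the maximum chain length in $P$. Stanley's toric polynomials are defined by $g(\emptyset,x)=1$, $f(P,x)=\sum_{t\in P} g([\hat 0,t),x)\,(x-1)^{n-\rho(t)}$, and, for $t$ of rank $r+1\ge 1$ with $f([\hat 0,t),x)=k_0+k_1x+\cdots$, by $g([\hat 0,t),x)=\sum_{i=0}^{\lfloor r/2\rfloor}(k_i-k_{i-1})x^i$, where $k_{-1}=0$. Let $F_1,\dots,F_r$ be a shelling of a finite $(d-1)$-dimensional cubical complex, that is, a list of its facets, all of dimension $d-1$, such that for $t>1$ the intersection $F_t\cap(F_1\cup\cdots\cup F_{t-1})$ is a union of $(d-2)$-dimensional faces of $F_t$, made up of $i$ antipodally unpaired faces and $j$ pairs of antipodal faces, where $i=0$ only if $j=d-1$. The pair $(i,j)$ is the type of the shelling component $F_t$; the type of $F_1$ is $(0,0)$. The contribution of $F_t$ is the polynomial $f(P_t,x)-f(P_{t-1},x)$, where $P_t$ is the face poset (including the empty face) of $F_1\cup\cdots\cup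 F_t$, and $f(P_0,x)$ is taken to be $0$. A plane tree is a rooted tree in which the children of each vertex are linearly ordered from left to right. Its vertices are labeled $1,2,\dots$ in postorder: recursively, first the vertices of the subtrees of the root, from left to right, and then the root. A vertex $v$ is of - type $(0)$ if $v$ is a leaf and the leftmost child of its parent, and the parent is not the root; - type $(1)$ if $v$ is a leaf, and $v$ is either the leftmost child of the root or a child, but not the leftmost child, of its parent; - type $(2)$ if $v$ is not a leaf and is the leftmost child of its parent; - type $[0]$ if $v$ is a leaf and the leftmost child of its parent; - type $[1]$ if $v$ is a leaf and a child, but not the leftmost child, of its parent; - type $[2]$ if $v$ is not a leaf and is the leftmost child of its parent. **Theorem.** Let $F_t$ be a shelling component of type $(i,j)$ in a $(d-1)$-dimensional cubical complex, and assume $j<d-1$. Then the contribution of $F_t$ is $$f_d(i,j,x)=\sum_{k=0}^{d-1} C_{d-1-k}(1-x)^k x^{d-k}\sum_{s=0}^{j}\binom{j}{s}\binom{d+i+j-1-k-s}{k-s},\qquad C_n=\frac1{n+1}\binom{2n}{n},$$ where $\binom{a}{b}=0$ for $b<0$, and the following hold. 1. For $0\le m\le d$ the coefficient of $x^{d-m}$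 in $f_d(i,j,x)$ is the number of plane trees on $d$ vertices with exactly $m$ vertices $v$ such that $v$ is of type $(0)$, or $v$ is of type $(1)$ and its postorder label is at most $i$ or at least $d-j$, or $v$ is of type $(2)$ and its postorder label is at least $d-j$. 2. If $i>0$, then for $0\le m\le d$ the coefficient of $x^{d-m}$ in $f_d(i,j,x)$ is also the number of plane trees on $d$ vertices with exactly $m$ vertices $v$ such that $v$ is of type $[0]$, or $v$ is of type $[1]$ and its postorder label is at most $i$ or at least $d-j$, or $v$ is of type $[2]$ and its postorder label is at least $d-j$. In particular, all coefficients of $f_d(i,j,x)$ are nonnegative. -/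

import Mathlib

open Polynomial

/-! ### Toric polynomials of finite posets -/

namespace Toric

/-- The rank of `t`: the length of a longest chain of elements ending in `t`. -/
noncomputable def rk {P : Type*} [PartialOrder P] (t : P) : ℕ :=
  (Order.height t).toNat

/-- For `f = k₀ + k₁ x + ⋯` the polynomial `∑_{0 ≤ i ≤ ⌊n/2⌋} (kᵢ - kᵢ₋₁) xⁱ`, where `k₋₁ = 0`. -/
noncomputable def gTrunc (n : ℕ) (f : ℤ[X]) : ℤ[X] :=
  ∑ i ∈ Finset.range (n / 2 + 1),
    monomial i (f.coeff i - if i = 0 then 0 else f.coeff (i - 1))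

open Classical in
/-- Stanley's polynomial `g([0,t), x)`. If `t` is minimal then `[0,t)` is empty and `g = 1`.
Otherwise, with `rk t = n + 1`, it is the truncated difference of
`f([0,t), x) = ∑_{s < t} g([0,s), x) (x - 1)^(n - rk s)`. -/
noncomputable def g {P : Type*} [PartialOrder P] [Fintype P] (t : P) : ℤ[X] :=
  if IsMin t then 1
  else gTrunc (rk t - 1)
    (∑ s : {s : P // s < t}, g s.1 * (X - 1) ^ (rk t - 1 - rk s.1))
termination_by wellFounded_lt.wrap t
decreasing_by exact s.2

/-- Stanley's toric polynomial `f(P, x) = ∑_{t ∈ P} g([0,t), x) (x - 1)^(n - rk t)`, where `n` is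
the maximal length of a chain in `P`. The sum is `0` if `P` has no elements at all. -/
noncomputable def f (P : Type*) [PartialOrder P] [Fintype P] : ℤ[X] :=
  ∑ t : P, g t * (X - 1) ^ (Finset.univ.sup (fun s : P => rk s) - rk t)

end Toric

/-! ### Cubical complexes, shellings and their types -/

/-- The faces of the `n`-cube, as sets of vertices: the empty face, and the sets obtained by
prescribing some of the coordinates. -/
def IsCubeFace {n : ℕ} (s : Set (Fin n → Bool)) : Prop :=
  s = ∅ ∨ ∃ (A : Set (Fin n)) (w : Fin n → Bool), s = {v | ∀ k ∈ A, v k = w k}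

/-- A finite (abstract) cubical complex. Faces are given by their vertex sets, the empty set is a
face, faces intersect in faces, and the faces contained in a nonempty face `σ` form the face
lattice of a cube with vertex set `σ`. -/
structure CubicalComplex (V : Type*) [DecidableEq V] where
  faces : Finset (Finset V)
  empty_mem : ∅ ∈ faces
  inter_mem : ∀ σ ∈ faces, ∀ τ ∈ faces, σ ∩ τ ∈ faces
  cube : ∀ σ ∈ faces, σ.Nonempty → ∃ (n : ℕ) (e : (Fin n → Bool) ≃ {v // v ∈ σ}),
    ∀ τ ⊆ σ, τ ∈ faces ↔ IsCubeFace {x | (e x : V) ∈ τ}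

/-- Dimension plus one of a face of a cubical complex with vertex set `σ`: the empty face has
dimension `-1`, and a face with `2 ^ n` vertices has dimension `n`. -/
def faceRank {V : Type*} (σ : Finset V) : ℕ :=
  if σ.card = 0 then 0 else Nat.log 2 σ.card + 1

namespace CubicalComplex

variable {V : Type*} [DecidableEq V] (K : CubicalComplex V)

/-- `F` lists the facets (maximal faces) of `K`, each of them exactly once. -/
def IsFacetList {r : ℕ} (F : Fin r → Finset V) : Prop :=
  Function.Injective F ∧
    ∀ σ, (∃ s, F s = σ) ↔ (σ ∈ K.faces ∧ ∀ τ ∈ K.faces, σ ⊆ τ → τ = σ)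

/-- The faces of the union of the facets `F s` with `s ≤ t`. -/
def upTo {r : ℕ} (F : Fin r → Finset V) (t : Fin r) : Finset (Finset V) :=
  K.faces.filter (fun σ => ∃ s, s ≤ t ∧ σ ⊆ F s)

/-- The faces of the union of the facets `F s` with `s < t`. There are none (not even the empty
face) if `t` is the first index. -/
def before {r : ℕ} (F : Fin r → Finset V) (t : Fin r) : Finset (Finset V) :=
  K.faces.filter (fun σ => ∃ s, s < t ∧ σ ⊆ F s)

/-- The `(d - 2)`-dimensional faces of the facet `F t` that lie in the union of the earlier
facets. -/
def oldRidges (d : ℕ) {r : ℕ} (F : Fin r → Finset V) (t : Fin r) : Finset (Finset V) :=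
  (K.before F t).filter (fun G => G ⊆ F t ∧ faceRank G + 1 = d)

/-- The old ridges of `F t` whose antipode is an old ridge, too. Two facets of a cube are antipodal
if they are distinct and have no common vertex. -/
def pairedRidges (d : ℕ) {r : ℕ} (F : Fin r → Finset V) (t : Fin r) : Finset (Finset V) :=
  (K.oldRidges d F t).filter (fun G => ∃ G' ∈ K.oldRidges d F t, G ≠ G' ∧ G ∩ G' = ∅)

/-- The facet `F t` has type `(i, j)`: among the `(d - 2)`-dimensional faces of `F t` that lie in
the union of the earlier facets there are `i` antipodally unpaired ones and `j` antipodal pairs. -/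
def HasType (d : ℕ) {r : ℕ} (F : Fin r → Finset V) (t : Fin r) (i j : ℕ) : Prop :=
  (K.oldRidges d F t \ K.pairedRidges d F t).card = i ∧ (K.pairedRidges d F t).card = 2 * j

/-- `F` is a shelling of the `(d - 1)`-dimensional cubical complex `K`: it lists the facets, all of
them have dimension `d - 1`, and each facet but the first one meets the union of the earlier ones
in a union of `(d - 2)`-dimensional faces, consisting of `i` antipodally unpaired and `j` pairs of
antipodal faces, where `i = 0` only if `j = d - 1`. -/
def IsShelling (d : ℕ) {r : ℕ} (F : Fin r → Finset V) : Prop :=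
  K.IsFacetList F ∧ (∀ t, faceRank (F t) = d) ∧
    ∀ t : Fin r, 0 < t.val →
      (∀ σ ∈ K.before F t, σ ⊆ F t → ∃ G ∈ K.oldRidges d F t, σ ⊆ G) ∧
      ∃ i j, K.HasType d F t i j ∧ (i = 0 → j = d - 1)

/-- The contribution of the facet `F t` to the toric polynomial: the change of `f(P, x)`, for the
face poset `P`, when `F t` is added to the union of the earlier facets. -/
noncomputable def contribution {r : ℕ} (F : Fin r → Finset V) (t : Fin r) : ℤ[X] :=
  Toric.f {σ // σ ∈ K.upTo F t} - Toric.f {σ // σ ∈ K.before F t}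

end CubicalComplex

/-- The polynomial `f_d(i,j,x)` for `j ≠ d - 1`:
`∑_{k < d} C_{d-1-k} (1-x)^k x^(d-k) ∑_{s ≤ j} (j choose s) (d+i+j-1-k-s choose k-s)`.
Terms with `s > k` vanish. -/
noncomputable def shellPoly (d i j : ℕ) : ℤ[X] :=
  ∑ k ∈ Finset.range d, (catalan (d - 1 - k) : ℤ[X]) * (1 - X) ^ k * X ^ (d - k) *
    ∑ s ∈ Finset.range (j + 1),
      if s ≤ k then (j.choose s : ℤ[X]) * ((d + i + j - 1 - k - s).choose (k - s) : ℤ[X]) else 0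

/-! ### Plane trees -/

/-- A plane tree: a root with an ordered list of subtrees. -/
inductive PlaneTree : Type
  | node : List PlaneTree → PlaneTree

namespace PlaneTree

/- A vertex is given by its address: the root is `[]`, and the `k`-th child (counted from `0`, left
to right) of the vertex `v` is `v ++ [k]`. -/
mutual
/-- The vertices in postorder: first the vertices of the subtrees, left to right, then the root. -/
def postorder : PlaneTree → List (List ℕ)
  | .node ts => postorderForest 0 ts ++ [[]]
/-- The vertices of the subtrees `ts`, which are the children number `k, k + 1, …` of the root. -/
def postorderForest : ℕ → List PlaneTree → List (List ℕ)
  | _, [] => []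
  | k, t :: ts => (postorder t).map (fun v => k :: v) ++ postorderForest (k + 1) ts
end

/-- The set of vertices. -/
def vertices (T : PlaneTree) : Finset (List ℕ) := T.postorder.toFinset

/-- The label of a vertex in postorder; labels start with `1`. -/
def label (T : PlaneTree) (v : List ℕ) : ℕ := T.postorder.idxOf v + 1

/-- `v` is a leaf: it has no child. -/
abbrev IsLeaf (T : PlaneTree) (v : List ℕ) : Prop :=
  v ∈ T.vertices ∧ v ++ [0] ∉ T.vertices

/-- `v` is the leftmost child of its parent. -/
abbrev IsFirstChild (T : PlaneTree) (v : List ℕ) : Prop :=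
  v ∈ T.vertices ∧ v.getLast? = some 0

/-- `v` is a child of its parent, but not the leftmost one. -/
abbrev IsLaterChild (T : PlaneTree) (v : List ℕ) : Prop :=
  v ∈ T.vertices ∧ v ≠ [] ∧ v.getLast? ≠ some 0

/-- `v` is a child of the root. -/
abbrev IsRootChild (T : PlaneTree) (v : List ℕ) : Prop :=
  v ∈ T.vertices ∧ v.length = 1

/-- Type `(0)`: a leaf that is the leftmost child of a parent other than the root. -/
abbrev Round0 (T : PlaneTree) (v : List ℕ) : Prop :=
  T.IsLeaf v ∧ T.IsFirstChild v ∧ ¬ T.IsRootChild v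

/-- Type `(1)`: a leaf that is the leftmost child of the root or a non-leftmost child of its
parent. -/
abbrev Round1 (T : PlaneTree) (v : List ℕ) : Prop :=
  T.IsLeaf v ∧ ((T.IsFirstChild v ∧ T.IsRootChild v) ∨ T.IsLaterChild v)

/-- Type `(2)`, which is the same as type `[2]`: a leftmost child that is not a leaf. -/
abbrev Round2 (T : PlaneTree) (v : List ℕ) : Prop :=
  ¬ T.IsLeaf v ∧ T.IsFirstChild v

/-- Type `[0]`: a leaf that is the leftmost child of its parent. -/
abbrev Square0 (T : PlaneTree) (v : List ℕ) : Prop :=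
  T.IsLeaf v ∧ T.IsFirstChild v

/-- Type `[1]`: a leaf that is a non-leftmost child of its parent. -/
abbrev Square1 (T : PlaneTree) (v : List ℕ) : Prop :=
  T.IsLeaf v ∧ T.IsLaterChild v

/-- Type `[2]`: a leftmost child that is not a leaf. -/
abbrev Square2 (T : PlaneTree) (v : List ℕ) : Prop :=
  ¬ T.IsLeaf v ∧ T.IsFirstChild v

/-- The number of vertices that are of type `(0)`, or of type `(1)` with a label that is at most `i`
or at least `d - j`, or of type `(2)` with a label that is at least `d - j`. -/
def roundCount (d i j : ℕ) (T : PlaneTree) : ℕ :=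
  (T.vertices.filter (fun v => T.Round0 v ∨
    (T.Round1 v ∧ (T.label v ≤ i ∨ d - j ≤ T.label v)) ∨
    (T.Round2 v ∧ d - j ≤ T.label v))).card

/-- The number of vertices that are of type `[0]`, or of type `[1]` with a label that is at most `i`
or at least `d - j`, or of type `[2]` with a label that is at least `d - j`. -/
def squareCount (d i j : ℕ) (T : PlaneTree) : ℕ :=
  (T.vertices.filter (fun v => T.Square0 v ∨
    (T.Square1 v ∧ (T.label v ≤ i ∨ d - j ≤ T.label v)) ∨
    (T.Square2 v ∧ d - j ≤ T.label v))).card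

end PlaneTree

-- Everything is expressed through one linear functional Λ on ℤ[x][X], `umbral cubeG`, which sends
-- X^n to the toric polynomial g_n of the n-cube.
--
-- Geometry. A nonempty face of an n-cube either leaves a coordinate free or fixes it to one of two
-- values. For a component after the first, with d = n + 1, a face is new exactly when no fixed
-- coordinate puts it into an old facet. A direction with c new facets thus contributes a factor X +
-- c(x-1), and the contribution is Λ(X^j (X+(x-1))^i (X+2(x-1))^m) with m + i + j = n. Pascal's rule
-- gives recurrences of the double sum in i and j which say that raising i (or j) replaces a factor
-- X + c by X + c + a (or X + c + 2a). So `linearMap_eq_shellSum` reduces the formula to i = j = 0,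
-- the full cube. There it is the identity `umbral_cubeG`, which follows from the Catalan equation
-- for generating functions and also drives the induction that identifies g_n (`g_eq_rankG`). The
-- empty face accounts for a correction term (x-1)^(n+1); it is annihilated as soon as i > 0, in
-- accordance with the empty face being old.
--
-- Combinatorics. Reversing coefficients turns `shellSum (1 - X) X` into `shellSum (X - 1) 1`, which
-- is Λ((X+2(x-1))^j (X+(x-1))^i X^m). On the other side, recording for each non-root vertex in
-- postorder whether it is a leaf and whether it is a leftmost child turns a tree with at least two
-- vertices into a forced up step followed by a Motzkin path with two kinds of level steps. The
-- level weights are 2 + u, where u is x-1, 2(x-1) or 0 according to the label, and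
-- `pathSum_eq_umbral` evaluates the weighted path count as Λ of (X+(x-1)) times the product of the
-- factors X + u. For i > 0 this gives the square count, and the two counts agree because they could
-- differ only at a vertex with label 1. For i = 0 the component is the first one, so j = 0, and the
-- round count is found by induction on the number of vertices.

section Algebra

-- Recurrences in i and j, and the umbral functional

variable {R : Type*} [CommRing R]

/-- The inner sum in the definition of `shellPoly`, as a natural number. -/
def shellCoeff (n i j k : ℕ) : ℕ :=
  ∑ s ∈ Finset.range (j + 1),
    if s ≤ k then j.choose s * (n + i + j - k - s).choose (k - s) else 0

/-- The two-parameter version of `shellPoly`, with `1 - x` and `x` replaced by `a` and `b`. -/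
noncomputable def shellSum (a b : R) (n i j : ℕ) : R :=
  ∑ k ∈ Finset.range (n + 1), (catalan (n - k) : R) * a ^ k * b ^ (n + 1 - k) *
    (shellCoeff n i j k : R)

theorem shellPoly_succ (n i j : ℕ) :
    shellPoly (n + 1) i j = shellSum (1 - X) X n i j := by
  unfold shellPoly shellSum shellCoeff
  refine Finset.sum_congr rfl fun k _ => ?_
  push_cast
  congr 1
  refine Finset.sum_congr rfl fun s _ => ?_
  split_ifs
  · congr 4
    omega
  · rfl

theorem shellCoeff_zero_zero (n k : ℕ) : shellCoeff n 0 0 k = (n - k).choose k := by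
  simp [shellCoeff]

theorem shellCoeff_zero_right (n i j : ℕ) : shellCoeff n i j 0 = 1 := by
  rw [shellCoeff, Finset.sum_eq_single 0] <;> simp +contextual

/-- Pascal's rule in each summand; the boundary term s = k + 1 is the same on both sides. The
hypothesis `hk` keeps the truncated subtractions honest. -/
theorem shellCoeff_succ_left (n i j k : ℕ) (hk : k ≤ n) :
    shellCoeff (n + 1) (i + 1) j (k + 1) =
      shellCoeff (n + 1) i j (k + 1) + shellCoeff n i j k := by
  have key : ∀ s ∈ Finset.range (j + 1),
      (if s ≤ k + 1 then
        j.choose s * (n + 1 + (i + 1) + j - (k + 1) - s).choose (k + 1 - s) else 0) =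
      (if s ≤ k + 1 then j.choose s * (n + 1 + i + j - (k + 1) - s).choose (k + 1 - s) else 0) +
      (if s ≤ k then j.choose s * (n + i + j - k - s).choose (k - s) else 0) := by
    intro s hs
    have hs' : s ≤ j := Nat.lt_succ_iff.mp (Finset.mem_range.mp hs)
    rcases Nat.lt_or_ge k s with h | h
    · rcases Nat.lt_or_ge (k + 1) s with h' | h'
      · simp [Nat.not_le.mpr h, Nat.not_le.mpr h']
      · obtain rfl : s = k + 1 := by omega
        simp
    · have e1 : n + 1 + (i + 1) + j - (k + 1) - s = (n + i + j - k - s) + 1 := by omega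
      have e2 : n + 1 + i + j - (k + 1) - s = n + i + j - k - s := by omega
      have e3 : k + 1 - s = (k - s) + 1 := by omega
      rw [if_pos (by omega), if_pos (by omega), if_pos h, e1, e2, e3, Nat.choose_succ_succ]
      ring
  rw [shellCoeff, Finset.sum_congr rfl key, Finset.sum_add_distrib]
  rfl

/-- Pascal's rule for (j+1 choose s) splits off one copy of `shellCoeff n i j k` and leaves the sum
with i + 1 in place of i. The rule for i then supplies the second copy, hence the factor 2. -/
theorem shellCoeff_succ_right (n i j k : ℕ) (hk : k ≤ n) :
    shellCoeff (n + 1) i (j + 1) (k + 1) =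
      shellCoeff (n + 1) i j (k + 1) + 2 * shellCoeff n i j k := by
  have h1 : shellCoeff (n + 1) i (j + 1) (k + 1) =
      (∑ s ∈ Finset.range (j + 1), if s ≤ k + 1 then
        j.choose s * (n + 1 + (i + 1) + j - (k + 1) - s).choose (k + 1 - s) else 0) +
      shellCoeff n i j k := by
    unfold shellCoeff
    rw [Finset.sum_range_succ']
    simp only [Nat.choose_succ_succ, add_mul, Nat.succ_eq_add_one]
    have h2 : ∀ s ∈ Finset.range (j + 1), (if s + 1 ≤ k + 1 then
        j.choose s * (n + 1 + i + (j + 1) - (k + 1) - (s + 1)).choose (k + 1 - (s + 1)) +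
        j.choose (s + 1) * (n + 1 + i + (j + 1) - (k + 1) - (s + 1)).choose (k + 1 - (s + 1))
        else 0) =
        (if s ≤ k then j.choose s * (n + i + j - k - s).choose (k - s) else 0) +
        (if s + 1 ≤ k + 1 then j.choose (s + 1) *
          (n + 1 + (i + 1) + j - (k + 1) - (s + 1)).choose (k + 1 - (s + 1)) else 0) := by
      intro s hs
      have hs' : s ≤ j := Nat.lt_succ_iff.mp (Finset.mem_range.mp hs)
      by_cases h : s ≤ k
      · have e1 : n + 1 + i + (j + 1) - (k + 1) - (s + 1) = n + i + j - k - s := by omega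
        have e2 : n + 1 + (i + 1) + j - (k + 1) - (s + 1) = n + i + j - k - s := by omega
        rw [if_pos (by omega), if_pos h, if_pos (by omega), e1, e2, Nat.add_sub_add_right]
      · rw [if_neg (by omega), if_neg h, if_neg (by omega)]
    rw [Finset.sum_congr rfl h2, Finset.sum_add_distrib, add_assoc, add_comm]
    congr 1
    rw [Finset.sum_range_succ, Finset.sum_range_succ' _ j]
    simp only [Nat.choose_succ_self, zero_mul, ite_self, add_zero]
    have e1 : n + 1 + i + (j + 1) = n + 1 + (i + 1) + j := by omega
    rw [e1]
    simp only [Nat.choose_zero_right]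
  rw [h1]
  have := shellCoeff_succ_left n i j k hk
  unfold shellCoeff at this ⊢
  omega

/-- Common source of the recurrences in i (with e = 1) and in j (with e = 2): a shift of k by one
costs exactly one factor a, because n - k and the exponent of b are unchanged. -/
theorem shellSum_shift (a b : R) (n i j : ℕ) (c : ℕ → ℕ) (e : ℕ) (i' j' : ℕ)
    (h0 : c 0 = 1)
    (h : ∀ k ≤ n, c (k + 1) = shellCoeff (n + 1) i j (k + 1) + e * shellCoeff n i j k)
    (hc : ∀ k, shellCoeff (n + 1) i' j' k = c k) :
    shellSum a b (n + 1) i' j' =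
      shellSum a b (n + 1) i j + e * a * shellSum a b n i j := by
  unfold shellSum
  rw [Finset.sum_range_succ', Finset.sum_range_succ' _ (n + 1), Finset.mul_sum]
  have : ∀ k ∈ Finset.range (n + 1), (catalan (n + 1 - (k + 1)) : R) * a ^ (k + 1) *
      b ^ (n + 1 + 1 - (k + 1)) * (shellCoeff (n + 1) i' j' (k + 1) : R) =
      (catalan (n + 1 - (k + 1)) : R) * a ^ (k + 1) *
      b ^ (n + 1 + 1 - (k + 1)) * (shellCoeff (n + 1) i j (k + 1) : R) +
      e * a * ((catalan (n - k) : R) * a ^ k * b ^ (n + 1 - k) * (shellCoeff n i j k : R)) := by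
    intro k hk
    rw [hc, h k (Nat.lt_succ_iff.mp (Finset.mem_range.mp hk)), Nat.add_sub_add_right,
      Nat.add_sub_add_right]
    push_cast
    ring
  rw [Finset.sum_congr rfl this, Finset.sum_add_distrib, hc, h0, shellCoeff_zero_right]
  ring

theorem shellSum_succ_left (a b : R) (n i j : ℕ) :
    shellSum a b (n + 1) (i + 1) j = shellSum a b (n + 1) i j + a * shellSum a b n i j := by
  have := shellSum_shift a b n i j (shellCoeff (n + 1) (i + 1) j) 1 (i + 1) j
    (shellCoeff_zero_right _ _ _)
    (fun k hk => by rw [shellCoeff_succ_left n i j k hk, one_mul]) fun _ => rfl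
  simpa using this

theorem shellSum_succ_right (a b : R) (n i j : ℕ) :
    shellSum a b (n + 1) i (j + 1) = shellSum a b (n + 1) i j + 2 * a * shellSum a b n i j := by
  have := shellSum_shift a b n i j (shellCoeff (n + 1) i (j + 1)) 2 i (j + 1)
    (shellCoeff_zero_right _ _ _)
    (fun k hk => shellCoeff_succ_right n i j k hk) fun _ => rfl
  simpa using this

/-- The recurrences in `i` and `j` determine `shellSum` from its values at `i = j = 0`. -/
theorem linearMap_eq_shellSum (Λ : R[X] →ₗ[R] R) (a b c : R)
    (h : ∀ n, Λ ((X + C c) ^ n) = shellSum a b n 0 0) (i j m : ℕ) :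
    Λ ((X + C (c + 2 * a)) ^ j * (X + C (c + a)) ^ i * (X + C c) ^ m) =
      shellSum a b (m + i + j) i j := by
  induction j generalizing m with
  | zero =>
    simp only [pow_zero, one_mul, add_zero]
    induction i generalizing m with
    | zero => simpa using h m
    | succ i ih =>
      -- Split X + c + a into (X + c) + a: one part raises m, the other lowers the total degree,
      -- just as in the recurrence.
      have e : (X + C (c + a)) ^ (i + 1) * (X + C c) ^ m =
          (X + C (c + a)) ^ i * (X + C c) ^ (m + 1) +
            a • ((X + C (c + a)) ^ i * (X + C c) ^ m) := by
        rw [smul_eq_C_mul]; simp only [C_add]; ring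
      rw [e, map_add, map_smul, ih, ih, smul_eq_mul, ← add_assoc, shellSum_succ_left]
      congr 2
      omega
  | succ j ih =>
    have e : (X + C (c + 2 * a)) ^ (j + 1) * (X + C (c + a)) ^ i * (X + C c) ^ m =
        (X + C (c + 2 * a)) ^ j * (X + C (c + a)) ^ i * (X + C c) ^ (m + 1) +
          (2 * a) • ((X + C (c + 2 * a)) ^ j * (X + C (c + a)) ^ i * (X + C c) ^ m) := by
      rw [smul_eq_C_mul]; simp only [C_add, C_mul]; ring
    rw [e, map_add, map_smul, ih, ih, smul_eq_mul, ← add_assoc, shellSum_succ_right]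
    congr 2
    omega

/-- The linear functional on polynomials that sends `X ^ n` to `u n`. -/
noncomputable def umbral (u : ℕ → R) : R[X] →ₗ[R] R := (Polynomial.basisMonomials R).constr R u

@[simp]
theorem umbral_X_pow (u : ℕ → R) (n : ℕ) : umbral u (X ^ n) = u n := by
  have := (Polynomial.basisMonomials R).constr_basis R u n
  rw [coe_basisMonomials] at this
  rw [X_pow_eq_monomial]
  exact this

theorem linearMap_ext_X_pow {f g : R[X] →ₗ[R] R} (h : ∀ n, f (X ^ n) = g (X ^ n)) : f = g := by
  refine (Polynomial.basisMonomials R).ext fun n => ?_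
  rw [coe_basisMonomials]
  have := h n
  rwa [X_pow_eq_monomial] at this

theorem umbral_X_add_C_pow (u : ℕ → R) (c : R) (n : ℕ) :
    umbral u ((X + C c) ^ n) =
      ∑ k ∈ Finset.range (n + 1), (n.choose k : R) * c ^ (n - k) * u k := by
  rw [add_pow, map_sum]
  refine Finset.sum_congr rfl fun k _ => ?_
  have : (X : R[X]) ^ k * C c ^ (n - k) * (n.choose k : R[X]) =
      ((n.choose k : R) * c ^ (n - k)) • X ^ k := by
    rw [smul_eq_C_mul]; simp only [C_mul, C_pow, map_natCast]; ring
  rw [this, map_smul, umbral_X_pow, smul_eq_mul]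

end Algebra

-- Generating functions at i = j = 0

section Series

open PowerSeries

variable {R : Type*} [CommRing R]

/-- The generating function of `shellSum a b n 0 0`. -/
noncomputable def shellSeries (a b : R) : R⟦X⟧ := PowerSeries.mk fun n => shellSum a b n 0 0

/-- With z the variable of the series, this is b times the Catalan series at u = b z (1 + a z): the
coefficient of z^n in u^m is b^m (m choose n-m) a^(n-m), and m = n - k recovers the defining sum. -/
theorem shellSeries_eq_subst (a b : R) :
    shellSeries a b = PowerSeries.C b *
      (PowerSeries.subst (PowerSeries.C b * PowerSeries.X * (1 + PowerSeries.C a * PowerSeries.X))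
        (PowerSeries.map (Nat.castRingHom R) catalanSeries) : R⟦X⟧) := by
  set u : R⟦X⟧ := PowerSeries.C b * PowerSeries.X * (1 + PowerSeries.C a * PowerSeries.X) with hu
  have hs : PowerSeries.HasSubst u := by
    refine PowerSeries.HasSubst.of_constantCoeff_zero' ?_
    simp [hu]
  ext n
  have hco : ∀ m, PowerSeries.coeff n (u ^ m) =
      if m ≤ n then b ^ m * (m.choose (n - m) : R) * a ^ (n - m) else 0 := by
    intro m
    have : u ^ m = PowerSeries.C (b ^ m) *
        (PowerSeries.X ^ m * (PowerSeries.C a * PowerSeries.X + 1) ^ m) := by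
      rw [hu, mul_pow, mul_pow, ← map_pow, add_comm]; ring
    rw [this, PowerSeries.coeff_C_mul, PowerSeries.coeff_X_pow_mul']
    split_ifs with h
    · rw [add_pow, map_sum]
      have : ∀ k ∈ Finset.range (m + 1), PowerSeries.coeff (n - m)
          ((PowerSeries.C a * PowerSeries.X) ^ k * 1 ^ (m - k) * (m.choose k : R⟦X⟧)) =
          if n - m = k then a ^ k * (m.choose k : R) else 0 := by
        intro k _
        have : (PowerSeries.C a * PowerSeries.X) ^ k * 1 ^ (m - k) * (m.choose k : R⟦X⟧) =
            PowerSeries.C (a ^ k * (m.choose k : R)) * PowerSeries.X ^ k := by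
          rw [map_mul, map_pow, map_natCast]; ring
        rw [this, PowerSeries.coeff_C_mul, PowerSeries.coeff_X_pow]
        simp
      rw [Finset.sum_congr rfl this, Finset.sum_ite_eq]
      split_ifs with h'
      · ring
      · rw [Nat.choose_eq_zero_of_lt (by simp at h'; omega)]; simp
    · simp
  rw [PowerSeries.coeff_C_mul, PowerSeries.coeff_subst' hs,
    finsum_eq_sum_of_support_subset (s := Finset.range (n + 1))]
  · rw [shellSeries, PowerSeries.coeff_mk, shellSum, ← Finset.sum_range_reflect, Finset.mul_sum]
    refine Finset.sum_congr rfl fun k hk => ?_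
    have hk' : k ≤ n := Nat.lt_succ_iff.mp (Finset.mem_range.mp hk)
    rw [hco, if_pos hk', shellCoeff_zero_zero]
    have e1 : n + 1 - 1 - k = n - k := by omega
    have e2 : n - (n - k) = k := by omega
    have e3 : n + 1 - (n - k) = k + 1 := by omega
    simp only [e1, e2, e3, PowerSeries.coeff_map, catalanSeries_coeff, smul_eq_mul]
    simp only [Nat.coe_castRingHom]
    ring
  · intro m hm
    by_contra h
    apply hm
    simp only [Finset.coe_range, Set.mem_Iio, not_lt] at h
    simp only [hco]
    rw [if_neg (by omega), smul_zero]

theorem shellSeries_eq (a b : R) :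
    shellSeries a b = PowerSeries.C b +
      PowerSeries.X * (1 + PowerSeries.C a * PowerSeries.X) * shellSeries a b ^ 2 := by
  set u : R⟦X⟧ := PowerSeries.C b * PowerSeries.X * (1 + PowerSeries.C a * PowerSeries.X) with hu
  have hs : PowerSeries.HasSubst u := by
    refine PowerSeries.HasSubst.of_constantCoeff_zero' ?_
    simp [hu]
  have h1 := congrArg (PowerSeries.map (Nat.castRingHom R)) catalanSeries_sq_mul_X_add_one
  have h2 := congrArg (PowerSeries.subst u) h1
  simp only [map_add, map_mul, map_pow, PowerSeries.map_X, map_one] at h2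
  rw [PowerSeries.subst_add hs, PowerSeries.subst_mul hs, PowerSeries.subst_pow hs,
    PowerSeries.subst_X hs] at h2
  have h3 : PowerSeries.subst u (1 : R⟦X⟧) = 1 := by
    rw [← PowerSeries.coe_substAlgHom hs, map_one]
  rw [h3] at h2
  rw [shellSeries_eq_subst, ← hu]
  set c : R⟦X⟧ := PowerSeries.subst u (PowerSeries.map (Nat.castRingHom R) catalanSeries)
  nth_rw 1 [← h2]
  rw [hu]
  ring

/-- The difference of two solutions W, V is annihilated by 1 - z(1 + az)(W + V), whose constant term
is 1. -/
theorem eq_shellSeries [IsDomain R] (a b : R) (W : R⟦X⟧)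
    (hW : W = PowerSeries.C b + PowerSeries.X * (1 + PowerSeries.C a * PowerSeries.X) * W ^ 2) :
    W = shellSeries a b := by
  have h := shellSeries_eq a b
  set V := shellSeries a b
  have h0 : (W - V) * (1 - PowerSeries.X * ((1 + PowerSeries.C a * PowerSeries.X) * (W + V))) = 0 := by
    linear_combination hW - h
  rcases mul_eq_zero.mp h0 with h1 | h1
  · exact sub_eq_zero.mp h1
  · have := congrArg PowerSeries.constantCoeff h1
    simp at this

/-- The generating function of the binomial transform of a sequence. -/
theorem binomial_transform (c : R) (f : R⟦X⟧) :
    (PowerSeries.mk fun n => ∑ k ∈ Finset.range (n + 1),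
      (n.choose k : R) * c ^ (n - k) * PowerSeries.coeff k f) =
    PowerSeries.mk (fun n => c ^ n) *
      PowerSeries.subst (PowerSeries.X * PowerSeries.mk (fun n => c ^ n)) f := by
  set e : R⟦X⟧ := PowerSeries.mk (fun n => c ^ n) with he
  have hs : PowerSeries.HasSubst (PowerSeries.X * e) := by
    refine PowerSeries.HasSubst.of_constantCoeff_zero' ?_
    simp
  have he' : e = PowerSeries.rescale c (PowerSeries.mk 1) := by
    ext n; simp [he]
  have hco : ∀ n m, PowerSeries.coeff n (e * (PowerSeries.X * e) ^ m) =
      if m ≤ n then (n.choose m : R) * c ^ (n - m) else 0 := by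
    intro n m
    have : e * (PowerSeries.X * e) ^ m = PowerSeries.X ^ m * e ^ (m + 1) := by ring
    rw [this, PowerSeries.coeff_X_pow_mul']
    split_ifs with h
    · rw [he', ← map_pow, mk_one_pow_eq_mk_choose_add, PowerSeries.coeff_rescale,
        PowerSeries.coeff_mk, Nat.add_sub_cancel' h, mul_comm]
    · rfl
  ext n
  rw [PowerSeries.coeff_mk, PowerSeries.coeff_mul]
  simp_rw [PowerSeries.coeff_subst' hs]
  have hfin : ∀ p ∈ Finset.HasAntidiagonal.antidiagonal n, (∑ᶠ d, PowerSeries.coeff d f •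
      PowerSeries.coeff p.2 ((PowerSeries.X * e) ^ d)) = ∑ d ∈ Finset.range (n + 1),
      PowerSeries.coeff d f • PowerSeries.coeff p.2 ((PowerSeries.X * e) ^ d) := by
    intro p hp
    apply finsum_eq_sum_of_support_subset
    intro m hm
    by_contra h
    apply hm
    simp only [Finset.coe_range, Set.mem_Iio, not_lt] at h
    have := Finset.HasAntidiagonal.mem_antidiagonal.mp hp
    simp only [mul_pow, PowerSeries.coeff_X_pow_mul']
    rw [if_neg (by omega), smul_zero]
  rw [Finset.sum_congr rfl fun p hp => congrArg (PowerSeries.coeff p.1 e * ·) (hfin p hp)]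
  simp only [Finset.mul_sum]
  rw [Finset.sum_comm]
  refine Finset.sum_congr rfl fun k hk => ?_
  have hk' : k ≤ n := Nat.lt_succ_iff.mp (Finset.mem_range.mp hk)
  have := hco n k
  rw [PowerSeries.coeff_mul, if_pos hk'] at this
  rw [← this, Finset.sum_mul]
  refine Finset.sum_congr rfl fun p _ => ?_
  rw [smul_eq_mul]; ring

theorem geometric_mul (c : R) :
    PowerSeries.mk (fun n => c ^ n) * (1 - PowerSeries.C c * PowerSeries.X) = 1 := by
  ext n
  cases n with
  | zero => simp
  | succ n =>
    rw [mul_sub, mul_one, mul_left_comm, map_sub, PowerSeries.coeff_C_mul,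
      PowerSeries.coeff_succ_mul_X]
    simp [pow_succ, mul_comm, PowerSeries.coeff_one]

/-- With e = 1/(1 - 2yz), the binomial transform of G = `shellSeries y 1` is E = e G(ze), and it
satisfies (1 - 2yz)E = 1 + z(1 - yz)E². Adding y/(1 - yz) completes this to the quadratic equation
with parameters -y and 1 + y, whose solution is unique. -/
theorem sum_choose_shellSum [IsDomain R] (y : R) (n : ℕ) :
    (∑ k ∈ Finset.range (n + 1), (n.choose k : R) * (2 * y) ^ (n - k) * shellSum y 1 k 0 0) +
      y ^ (n + 1) = shellSum (-y) (1 + y) n 0 0 := by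
  set e : R⟦X⟧ := PowerSeries.mk (fun n => (2 * y) ^ n) with he
  have hs : PowerSeries.HasSubst (PowerSeries.X * e) := by
    refine PowerSeries.HasSubst.of_constantCoeff_zero' ?_
    simp
  have hb := binomial_transform (2 * y) (shellSeries y 1)
  rw [← he] at hb
  have hg := geometric_mul (2 * y)
  rw [← he] at hg
  have ht := geometric_mul y
  set t : R⟦X⟧ := PowerSeries.mk (fun n => y ^ n) with htd
  have hG := congrArg (PowerSeries.subst (PowerSeries.X * e)) (shellSeries_eq y 1)
  simp only [PowerSeries.subst_add hs, PowerSeries.subst_mul hs, PowerSeries.subst_pow hs,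
    PowerSeries.subst_X hs, map_one] at hG
  have h3 : PowerSeries.subst (PowerSeries.X * e) (1 : R⟦X⟧) = 1 := by
    rw [← PowerSeries.coe_substAlgHom hs, map_one]
  have h4 : PowerSeries.subst (PowerSeries.X * e) (PowerSeries.C y) = PowerSeries.C y := by
    rw [← PowerSeries.coe_substAlgHom hs]
    exact (PowerSeries.substAlgHom hs).commutes y
  rw [h3, h4] at hG
  set S := PowerSeries.subst (PowerSeries.X * e) (shellSeries y 1)
  have key : e * S + PowerSeries.C y * t = shellSeries (-y) (1 + y) := by
    apply eq_shellSeries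
    simp only [map_add, map_mul, map_neg, map_one, map_ofNat] at hg ht ⊢
    generalize (PowerSeries.C y : R⟦X⟧) = Y at *
    generalize (PowerSeries.X : R⟦X⟧) = Z at *
    have h2 : (e * S) * (1 - 2 * Y * Z) = 1 + Z * (1 - Y * Z) * (e * S) ^ 2 := by
      have : (e * S) * (1 - 2 * Y * Z) = S := by linear_combination S * hg
      rw [this, hG]
      have hg2 : 1 - 2 * Y * Z + Y * Z = 1 - Y * Z := by ring
      rw [← hG]
      linear_combination hG - Z * e * S ^ 2 * hg
    linear_combination h2 +
      (Y - Z * Y ^ 2 * t - 2 * Z * (e * S) * Y ) * ht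
  have := congrArg (PowerSeries.coeff n) key
  rw [← hb, map_add, PowerSeries.coeff_mk, PowerSeries.coeff_C_mul, shellSeries,
    PowerSeries.coeff_mk] at this
  simp only [shellSeries, PowerSeries.coeff_mk] at this
  rw [← this]
  ring

/-- The series `N = (1 + y z) G - 1`, where `G` is the generating function of `shellSum y 1 n 0 0`,
satisfies `N = z ((1 + y) + 2 N + N²)`. -/
theorem motzkin_series (y : R) (N : R⟦X⟧)
    (hN : N = (1 + PowerSeries.C y * PowerSeries.X) * shellSeries y 1 - 1) :
    N = PowerSeries.X * (PowerSeries.C (1 + y) + 2 * N + N ^ 2) := by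
  have h := shellSeries_eq y (1 : R)
  rw [hN]
  simp only [map_add, map_one] at h ⊢
  linear_combination (1 + PowerSeries.C y * PowerSeries.X) * h

end Series

-- Weighted Motzkin paths

section Paths

variable {R : Type*} [CommRing R]

/-- Weighted count of the paths in the upper half plane from height `h` to height `0`, whose
up steps have weight `q`, whose down steps have weight `1`, and whose level steps have the weights
given by the list. -/
def pathSum (q : R) : ℕ → List R → R
  | 0, [] => 1
  | _ + 1, [] => 0
  | 0, l :: ls => l * pathSum q 0 ls + q * pathSum q 1 ls
  | h + 1, l :: ls => l * pathSum q (h + 1) ls + q * pathSum q (h + 2) ls + pathSum q h ls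

theorem pathSum_cons_add (q : R) (h : ℕ) (a b : R) (ls : List R) :
    pathSum q h ((a + b) :: ls) = pathSum q h (a :: ls) + b * pathSum q h ls := by
  cases h <;> simp only [pathSum] <;> ring

/-- With all level weights 2, the equation N = z((1+y) + 2N + N²) multiplied by N^h is the
first-step recursion for paths from height h. The factor (1+y)^(h+1) normalizes the weights. -/
theorem pathSum_replicate (y : R) (n h : ℕ) :
    (1 + y) ^ (h + 1) * pathSum (1 + y) h (List.replicate n 2) =
      PowerSeries.coeff (n + 1)
        (((1 + PowerSeries.C y * PowerSeries.X) * shellSeries y 1 - 1) ^ (h + 1)) := by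
  set N := (1 + PowerSeries.C y * PowerSeries.X) * shellSeries y 1 - 1 with hN
  have hM := motzkin_series y N hN
  have hp : ∀ m h, PowerSeries.coeff (m + 1) (N ^ (h + 1)) =
      (1 + y) * PowerSeries.coeff m (N ^ h) + 2 * PowerSeries.coeff m (N ^ (h + 1)) +
        PowerSeries.coeff m (N ^ (h + 2)) := by
    intro m h
    have e : N ^ (h + 1) = (PowerSeries.C (1 + y) * N ^ h + PowerSeries.C 2 * N ^ (h + 1) +
        N ^ (h + 2)) * PowerSeries.X := by
      rw [map_ofNat]
      linear_combination N ^ h * hM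
    conv_lhs => rw [e]
    rw [PowerSeries.coeff_succ_mul_X, map_add, map_add, PowerSeries.coeff_C_mul,
      PowerSeries.coeff_C_mul]
  have hc : PowerSeries.constantCoeff N = 0 := by rw [hM]; simp
  induction n generalizing h with
  | zero =>
    rw [zero_add, hp]
    cases h <;> simp [pathSum, hc]
  | succ n ih =>
    rw [hp, ← ih, List.replicate_succ]
    have h2 := ih (h + 1)
    rw [← h2]
    cases h with
    | zero =>
      simp only [pathSum, pow_zero, PowerSeries.coeff_one]
      rw [if_neg (by omega)]
      ring
    | succ h =>
      rw [← ih h]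
      simp only [pathSum]
      ring

/-- The excess u of a level weight over 2 acts as deleting that step while keeping the height
(`pathSum_cons_add`). So paths with weights 2 + u are obtained by expanding the product of the X +
u, where X^n stands for n steps with level weight 2. For those the coefficient of N in degree n + 1
gives the base case, and its factor 1 + yz becomes X + y. -/
theorem pathSum_eq_umbral (y : R) (us : List R) :
    (1 + y) * pathSum (1 + y) 0 (us.map (2 + ·)) =
      umbral (fun n => shellSum y 1 n 0 0) ((X + C y) * (us.map (X + C ·)).prod) := by
  have hbase : ∀ n, (1 + y) * pathSum (1 + y) 0 (List.replicate n 2) =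
      umbral (fun n => shellSum y 1 n 0 0) ((X + C y) * X ^ n) := by
    intro n
    have := pathSum_replicate y n 0
    rw [zero_add, pow_one, pow_one] at this
    rw [this, add_mul, add_mul, one_mul, mul_assoc, map_sub, map_add, PowerSeries.coeff_C_mul,
      PowerSeries.coeff_succ_X_mul, PowerSeries.coeff_one, if_neg (by omega), ← pow_succ',
      ← smul_eq_C_mul, map_add, map_smul, umbral_X_pow, umbral_X_pow]
    simp [shellSeries]
  -- One functional for each starting height, since removing an up or down step changes the height.
  obtain ⟨U, hU⟩ : ∃ U : ℕ → R[X] →ₗ[R] R,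
      ∀ h n, U h (X ^ n) = pathSum (1 + y) h (List.replicate n 2) :=
    ⟨fun h => umbral fun n => pathSum (1 + y) h (List.replicate n 2),
      fun h n => umbral_X_pow _ n⟩
  have hpath : ∀ (us : List R) (h : ℕ), pathSum (1 + y) h (us.map (2 + ·)) =
      U h (us.map (X + C ·)).prod := by
    intro us
    induction us with
    | nil =>
      intro h
      have := hU h 0
      rw [pow_zero] at this
      simp [this]
    | cons u us ih =>
      intro h
      rw [List.map_cons, List.map_cons, List.prod_cons, pathSum_cons_add, add_mul, map_add, ih,
        ← smul_eq_C_mul, map_smul, smul_eq_mul]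
      congr 1
      generalize (us.map (X + C ·)).prod = P at ih ⊢
      cases h with
      | zero =>
        have e : (2 : R) • U 0 + (1 + y) • U 1 = U 0 ∘ₗ LinearMap.mulLeft R X :=
          linearMap_ext_X_pow fun n => by
            simp [hU, ← pow_succ', List.replicate_succ, pathSum]
        rw [pathSum, ih, ih]
        exact LinearMap.congr_fun e P
      | succ h =>
        have e : (2 : R) • U (h + 1) + (1 + y) • U (h + 2) + U h =
            U (h + 1) ∘ₗ LinearMap.mulLeft R X :=
          linearMap_ext_X_pow fun n => by
            simp [hU, ← pow_succ', List.replicate_succ, pathSum]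
        rw [pathSum, ih, ih, ih]
        exact LinearMap.congr_fun e P
  have e : (1 + y) • U 0 =
      umbral (fun n => shellSum y 1 n 0 0) ∘ₗ LinearMap.mulLeft R (X + C y) :=
    linearMap_ext_X_pow fun n => by
      simp only [LinearMap.smul_apply, hU, smul_eq_mul, hbase, LinearMap.comp_apply,
        LinearMap.mulLeft_apply]
  rw [hpath]
  exact LinearMap.congr_fun e _

end Paths

-- Faces of a cube as partial assignments

section CubeFaces

/-- The number of coordinates that a partial assignment leaves free. -/
def freeCount {n : ℕ} (p : Fin n → Option Bool) : ℕ :=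
  (Finset.univ.filter fun k => p k = none).card

/-- Summing a monomial weight over the faces of a cube all of whose fixed coordinates have allowed
values. -/
theorem sum_piFinset_freeCount {R : Type*} [CommRing R] (u : ℕ → R) (y : R) {n : ℕ}
    (A : Fin n → Finset Bool) :
    ∑ p ∈ Fintype.piFinset (fun k => Finset.insertNone (A k)),
      u (freeCount p) * y ^ (n - freeCount p) =
      umbral u (∏ k, (X + C ((A k).card * y))) := by
  -- The choices in one coordinate: free has weight X, each allowed value has weight y. Expanding
  -- the product over the coordinates then lists the faces.
  have h : ∀ k, (X + C ((A k).card * y) : R[X]) =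
      ∑ o ∈ Finset.insertNone (A k), if o = none then X else C y := by
    intro k
    rw [Finset.sum_insertNone]
    simp
  rw [Finset.prod_congr rfl fun k _ => h k, Finset.prod_univ_sum, map_sum]
  refine Finset.sum_congr rfl fun p _ => ?_
  rw [Finset.prod_ite, Finset.prod_const, Finset.prod_const, ← C_pow, mul_comm _ (C _),
    ← smul_eq_C_mul, map_smul, umbral_X_pow, smul_eq_mul, mul_comm]
  congr 2
  have := Finset.card_filter_add_card_filter_not (s := (Finset.univ : Finset (Fin n)))
    (fun k => p k = none)
  rw [Finset.card_univ, Fintype.card_fin] at this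
  unfold freeCount
  omega

variable {V : Type*} [DecidableEq V] {σ : Finset V} {n : ℕ}

/-- The face of a cube `σ` given by a partial assignment of its coordinates. -/
def cubeFace (e : (Fin n → Bool) ≃ {v // v ∈ σ}) (p : Fin n → Option Bool) : Finset V :=
  (Finset.univ.filter fun v : Fin n → Bool => ∀ k, p k = none ∨ p k = some (v k)).image
    fun v => (e v : V)

variable (e : (Fin n → Bool) ≃ {v // v ∈ σ})

theorem mem_cubeFace {p : Fin n → Option Bool} {v : Fin n → Bool} :
    (e v : V) ∈ cubeFace e p ↔ ∀ k, p k = none ∨ p k = some (v k) := by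
  unfold cubeFace
  rw [Finset.mem_image]
  constructor
  · rintro ⟨w, hw, h⟩
    rw [← e.injective (Subtype.ext h)]
    exact (Finset.mem_filter.mp hw).2
  · intro h
    exact ⟨v, Finset.mem_filter.mpr ⟨Finset.mem_univ _, h⟩, rfl⟩

theorem cubeFace_subset (p : Fin n → Option Bool) : cubeFace e p ⊆ σ := by
  intro x hx
  obtain ⟨v, _, rfl⟩ := Finset.mem_image.mp hx
  exact (e v).2

omit [DecidableEq V] in
theorem subset_iff_of_subset {τ τ' : Finset V} (h : τ ⊆ σ) :
    τ ⊆ τ' ↔ ∀ v, (e v : V) ∈ τ → (e v : V) ∈ τ' := by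
  constructor
  · exact fun h v hv => h hv
  · intro h' x hx
    have := h' (e.symm ⟨x, h hx⟩)
    simp only [Equiv.apply_symm_apply] at this
    exact this hx

theorem cubeFace_subset_cubeFace {p p' : Fin n → Option Bool} :
    cubeFace e p ⊆ cubeFace e p' ↔ ∀ k, p' k = none ∨ p' k = p k := by
  rw [subset_iff_of_subset e (cubeFace_subset e p)]
  simp only [mem_cubeFace]
  constructor
  · intro h k
    rcases hp' : p' k with _ | b
    · exact Or.inl rfl
    · right
      rcases hp : p k with _ | b'
      · exfalso
        -- If p leaves k free while p' fixes it to b, a vertex of the first face with k-th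
        -- coordinate `!b` is outside the second.
        have := h (fun l => if l = k then !b else (p l).getD true) (fun l => by
          by_cases hl : l = k
          · subst hl; simp [hp]
          · rcases hpl : p l with _ | c
            · simp
            · simp [hl]) k
        simp [hp'] at this
      · have := h (fun l => (p l).getD true) (fun l => by
          rcases hpl : p l with _ | c <;> simp) k
        simp [hp', hp] at this
        rw [this]
  · intro h v hv k
    rcases h k with h1 | h1
    · exact Or.inl h1
    · rw [h1]; exact hv k

theorem cubeFace_injective : Function.Injective (cubeFace e) := by
  intro p p' h
  have h1 := (cubeFace_subset_cubeFace e).mp h.subset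
  have h2 := (cubeFace_subset_cubeFace e).mp h.symm.subset
  funext k
  rcases h1 k with a | a <;> rcases h2 k with b | b <;> simp_all

theorem cubeFace_nonempty (p : Fin n → Option Bool) : (cubeFace e p).Nonempty :=
  ⟨e fun l => (p l).getD true, (mem_cubeFace e).mpr fun l => by
    rcases hpl : p l with _ | c <;> simp⟩

theorem card_cubeFace (p : Fin n → Option Bool) : (cubeFace e p).card = 2 ^ freeCount p := by
  unfold cubeFace
  rw [Finset.card_image_of_injective _ fun _ _ h => e.injective (Subtype.ext h)]
  have : (Finset.univ.filter fun v : Fin n → Bool => ∀ k, p k = none ∨ p k = some (v k)) =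
      Fintype.piFinset fun k => Finset.univ.filter fun b => p k = none ∨ p k = some b := by
    ext v; simp
  rw [this, Fintype.card_piFinset, freeCount, Finset.card_filter, ← Finset.prod_pow_eq_pow_sum]
  refine Finset.prod_congr rfl fun k _ => ?_
  rcases p k with _ | b
  · simp
  · cases b <;> simp <;> rfl

theorem faceRank_cubeFace (p : Fin n → Option Bool) :
    faceRank (cubeFace e p) = freeCount p + 1 := by
  unfold faceRank
  rw [card_cubeFace, if_neg (by positivity), Nat.log_pow Nat.one_lt_two]

theorem cubeFace_none : cubeFace e (fun _ => none) = σ := by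
  refine (cubeFace_subset e _).antisymm ((subset_iff_of_subset e subset_rfl).mpr fun v _ => ?_)
  exact (mem_cubeFace e).mpr fun _ => Or.inl rfl

theorem faceRank_of_equiv (e : (Fin n → Bool) ≃ {v // v ∈ σ}) : faceRank σ = n + 1 := by
  conv_lhs => rw [← cubeFace_none e]
  rw [faceRank_cubeFace]
  simp [freeCount]

end CubeFaces

-- Ranks in cubical complexes

namespace CubicalComplex

variable {V : Type*} [DecidableEq V] (K : CubicalComplex V) {σ : Finset V} {n : ℕ}

/-- The faces below `σ` are indexed by the faces of the standard cube. -/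
def IsCubeChart (σ : Finset V) (e : (Fin n → Bool) ≃ {v // v ∈ σ}) : Prop :=
  ∀ τ ⊆ σ, τ ∈ K.faces ↔ IsCubeFace {x | (e x : V) ∈ τ}

variable {K} {e : (Fin n → Bool) ≃ {v // v ∈ σ}}

theorem IsCubeChart.cubeFace_mem (he : K.IsCubeChart σ e) (p : Fin n → Option Bool) :
    cubeFace e p ∈ K.faces := by
  rw [he _ (cubeFace_subset e p)]
  refine Or.inr ⟨{k | p k ≠ none}, fun k => (p k).getD true, ?_⟩
  ext v
  simp only [Set.mem_ofPred_eq, mem_cubeFace]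
  refine forall_congr' fun k => ?_
  rcases p k with _ | b
  · simp
  · simp [eq_comm]

theorem IsCubeChart.exists_cubeFace (he : K.IsCubeChart σ e) {τ : Finset V} (hτ : τ ∈ K.faces)
    (hσ : τ ⊆ σ) (hne : τ.Nonempty) : ∃ p, cubeFace e p = τ := by
  classical
  rcases (he τ hσ).mp hτ with h | ⟨A, w, h⟩
  · exfalso
    obtain ⟨x, hx⟩ := hne
    have : e.symm ⟨x, hσ hx⟩ ∈ {x | (e x : V) ∈ τ} := by simpa using hx
    rw [h] at this
    exact this
  · refine ⟨fun k => if k ∈ A then some (w k) else none, ?_⟩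
    have key : ∀ v, (e v : V) ∈ cubeFace e (fun k => if k ∈ A then some (w k) else none) ↔
        (e v : V) ∈ τ := by
      intro v
      have : (e v : V) ∈ τ ↔ v ∈ {x | (e x : V) ∈ τ} := Iff.rfl
      rw [mem_cubeFace, this, h]
      refine forall_congr' fun k => ?_
      by_cases hk : k ∈ A <;> simp [hk, eq_comm]
    exact Finset.Subset.antisymm
      ((subset_iff_of_subset e (cubeFace_subset e _)).mpr fun v => (key v).mp)
      ((subset_iff_of_subset e hσ).mpr fun v => (key v).mpr)

theorem IsCubeChart.image_cubeFace (he : K.IsCubeChart σ e) :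
    Finset.univ.image (cubeFace e) = K.faces.filter fun τ => τ ⊆ σ ∧ τ.Nonempty := by
  ext τ
  simp only [Finset.mem_image, Finset.mem_univ, true_and, Finset.mem_filter]
  constructor
  · rintro ⟨p, rfl⟩
    exact ⟨he.cubeFace_mem p, cubeFace_subset e p, cubeFace_nonempty e p⟩
  · rintro ⟨h1, h2, h3⟩
    exact he.exists_cubeFace h1 h2 h3

theorem exists_isCubeChart {σ : Finset V} (hσ : σ ∈ K.faces) (hne : σ.Nonempty) :
    ∃ (n : ℕ) (e : (Fin n → Bool) ≃ {v // v ∈ σ}), K.IsCubeChart σ e :=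
  K.cube σ hσ hne

theorem card_face {σ : Finset V} (hσ : σ ∈ K.faces) (hne : σ.Nonempty) :
    ∃ n, σ.card = 2 ^ n ∧ faceRank σ = n + 1 := by
  obtain ⟨n, e, he⟩ := K.cube σ hσ hne
  refine ⟨n, ?_, faceRank_of_equiv e⟩
  have := Fintype.card_congr e
  simpa using this.symm

omit [DecidableEq V] in
theorem faceRank_empty : faceRank (∅ : Finset V) = 0 := by simp [faceRank]

theorem faceRank_lt {σ τ : Finset V} (hσ : σ ∈ K.faces) (hτ : τ ∈ K.faces) (h : τ ⊂ σ) :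
    faceRank τ < faceRank σ := by
  have hne : σ.Nonempty := Finset.nonempty_of_ne_empty fun h' => by
    subst h'; exact Finset.not_ssubset_empty _ h
  obtain ⟨a, ha, ha'⟩ := card_face hσ hne
  rcases τ.eq_empty_or_nonempty with rfl | hne'
  · rw [faceRank_empty, ha']; omega
  · obtain ⟨b, hb, hb'⟩ := card_face hτ hne'
    have := Finset.card_lt_card h
    rw [ha, hb, Nat.pow_lt_pow_iff_right Nat.one_lt_two] at this
    omega

theorem exists_faceRank_eq {σ : Finset V} (hσ : σ ∈ K.faces) (hne : σ.Nonempty) :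
    ∃ τ ∈ K.faces, τ ⊂ σ ∧ faceRank τ + 1 = faceRank σ := by
  obtain ⟨n, e, he⟩ := exists_isCubeChart hσ hne
  cases n with
  | zero =>
    refine ⟨∅, K.empty_mem, hne.empty_ssubset, ?_⟩
    rw [faceRank_empty, faceRank_of_equiv e]
  | succ n =>
    set p : Fin (n + 1) → Option Bool := fun k => if k = 0 then some true else none with hp
    have hr : faceRank (cubeFace e p) = n + 1 := by
      rw [faceRank_cubeFace]
      congr 1
      simp only [freeCount, hp]
      have : (Finset.univ.filter fun k : Fin (n + 1) =>
          (if k = 0 then some true else none) = none) = Finset.univ.erase 0 := by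
        ext k; simp
      rw [this]
      simp
    refine ⟨cubeFace e p, he.cubeFace_mem p, (cubeFace_subset e p).ssubset_of_ne fun h => ?_, ?_⟩
    · rw [h, faceRank_of_equiv e] at hr
      omega
    · rw [hr, faceRank_of_equiv e]

/-- A set of faces that is closed under passing to smaller faces. -/
def IsLowerFaces (K : CubicalComplex V) (S : Finset (Finset V)) : Prop :=
  S ⊆ K.faces ∧ ∀ σ ∈ S, ∀ τ ∈ K.faces, τ ⊆ σ → τ ∈ S

/-- The function `faceRank` is strictly monotone, which bounds the height above; every nonempty face
has a facet of rank one less, still in the lower set, which bounds it below. -/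
theorem height_eq_faceRank {S : Finset (Finset V)} (hS : K.IsLowerFaces S)
    (t : {σ // σ ∈ S}) : Order.height t = faceRank t.1 := by
  induction t using WellFoundedLT.induction with
  | ind t ih =>
    apply le_antisymm
    · have hmono : StrictMono fun t : {σ // σ ∈ S} => faceRank t.1 :=
        fun s s' h => faceRank_lt (hS.1 s'.2) (hS.1 s.2) h
      simpa using Order.height_le_height_apply_of_strictMono _ hmono t
    · rcases t.1.eq_empty_or_nonempty with h | h
      · rw [h, faceRank_empty]
        exact zero_le
      · obtain ⟨τ, h1, h2, h3⟩ := exists_faceRank_eq (hS.1 t.2) h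
        have hlt : (⟨τ, hS.2 _ t.2 _ h1 h2.subset⟩ : {σ // σ ∈ S}) < t := h2
        have := Order.height_add_one_le hlt
        rw [ih _ hlt] at this
        rw [← h3]
        exact_mod_cast this

theorem rk_eq_faceRank {S : Finset (Finset V)} (hS : K.IsLowerFaces S)
    (t : {σ // σ ∈ S}) : Toric.rk t = faceRank t.1 := by
  rw [Toric.rk, height_eq_faceRank hS, ENat.toNat_natCast]

end CubicalComplex

-- Toric polynomials of cubes and cubical complexes

section ToricCube

/-- The toric polynomial `g` of the `n`-cube. -/
noncomputable def cubeG (n : ℕ) : ℤ[X] := shellSum (X - 1) 1 n 0 0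

theorem natDegree_cubeG_le (n : ℕ) : (cubeG n).natDegree ≤ n / 2 := by
  unfold cubeG shellSum
  refine natDegree_sum_le_of_forall_le _ _ fun k hk => ?_
  rw [shellCoeff_zero_zero, one_pow, mul_one]
  rcases Nat.lt_or_ge (n - k) k with h | h
  · rw [Nat.choose_eq_zero_of_lt h]
    simp
  · have h1 : ((X - 1 : ℤ[X]) ^ k).natDegree ≤ k := by
      simpa using natDegree_pow_le_of_le k (natDegree_X_sub_C_le (1 : ℤ))
    have h2 := natDegree_mul_le (p := (catalan (n - k) : ℤ[X]) * (X - 1) ^ k)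
      (q := ((n - k).choose k : ℤ[X]))
    have h3 := natDegree_mul_le (p := (catalan (n - k) : ℤ[X])) (q := (X - 1) ^ k)
    rw [natDegree_natCast] at h2 h3
    omega

/-- A nonzero summand has 2k ≤ n, so its factor X^(n+1-k) has exponent greater than n/2. -/
theorem coeff_shellSum_eq_zero (n i : ℕ) (hi : i ≤ n / 2) :
    (shellSum (1 - X) X n 0 0 : ℤ[X]).coeff i = 0 := by
  unfold shellSum
  rw [finsetSum_coeff]
  refine Finset.sum_eq_zero fun k hk => ?_
  rw [shellCoeff_zero_zero]
  rcases Nat.lt_or_ge (n - k) k with h | h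
  · rw [Nat.choose_eq_zero_of_lt h]
    simp
  · rw [mul_right_comm, coeff_mul_X_pow', if_neg (by omega)]

/-- The differences of consecutive coefficients of f are the coefficients of (1 - X)f = G - H. Up to
degree n/2 only G is visible there, and G has nothing beyond. -/
theorem gTrunc_eq {n : ℕ} {f G H : ℤ[X]} (h : (X - 1) * f = H - G) (hG : G.natDegree ≤ n / 2)
    (hH : ∀ i ≤ n / 2, H.coeff i = 0) : Toric.gTrunc n f = G := by
  unfold Toric.gTrunc
  conv_rhs => rw [G.as_sum_range' (n / 2 + 1) (by omega)]
  refine Finset.sum_congr rfl fun i hi => ?_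
  congr 1
  have h1 := congrArg (coeff · i) h
  simp only [sub_mul, one_mul, coeff_sub] at h1
  rw [hH i (by simpa [Nat.lt_succ_iff] using hi)] at h1
  cases i with
  | zero =>
    simp at h1 ⊢
    linarith
  | succ i =>
    rw [coeff_X_mul] at h1
    simp only [Nat.add_eq_zero_iff, one_ne_zero, and_false, if_false, Nat.add_sub_cancel]
    linarith

/-- The toric polynomial `g` of a face of a cubical complex, as a function of its rank. -/
noncomputable def rankG : ℕ → ℤ[X]
  | 0 => 1
  | n + 1 => cubeG n

/-- The sum over all faces of the n-cube: the first term collects the nonempty faces, the power of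
x-1 is the empty face. -/
theorem umbral_cubeG (n : ℕ) :
    umbral cubeG ((X + C (2 * (X - 1))) ^ n) + (X - 1) ^ (n + 1) = shellSum (1 - X) X n 0 0 := by
  have := sum_choose_shellSum (X - 1 : ℤ[X]) n
  rw [umbral_X_add_C_pow]
  simp only [cubeG]
  rw [this]
  congr 1 <;> ring

end ToricCube

namespace CubicalComplex

variable {V : Type*} [DecidableEq V] {K : CubicalComplex V} {σ : Finset V} {n : ℕ}
  {e : (Fin n → Bool) ≃ {v // v ∈ σ}}

theorem IsCubeChart.sum_faces (he : K.IsCubeChart σ e) {M : Type*} [AddCommMonoid M]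
    (φ : Finset V → M) :
    ∑ τ ∈ K.faces.filter (fun τ => τ ⊆ σ ∧ τ.Nonempty), φ τ = ∑ p, φ (cubeFace e p) := by
  rw [← he.image_cubeFace, Finset.sum_image fun _ _ _ _ h => cubeFace_injective e h]

theorem IsCubeChart.sum_rankG (he : K.IsCubeChart σ e) :
    ∑ τ ∈ K.faces.filter (fun τ => τ ⊆ σ ∧ τ.Nonempty),
      rankG (faceRank τ) * (X - 1) ^ (n + 1 - faceRank τ) =
      umbral cubeG ((X + C (2 * (X - 1))) ^ n) := by
  rw [he.sum_faces]
  have := sum_piFinset_freeCount cubeG (X - 1) (fun _ : Fin n => Finset.univ)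
  simp only [Finset.card_univ, Fintype.card_bool, Finset.prod_const, Fintype.card_fin,
    Nat.cast_ofNat] at this
  rw [← this]
  refine Finset.sum_congr ?_ fun p _ => ?_
  · ext p
    simp [Fintype.mem_piFinset]
  · rw [faceRank_cubeFace, Nat.add_sub_add_right]
    rfl

theorem sum_subtype_eq {S : Finset (Finset V)} {M : Type*} [AddCommMonoid M]
    (φ : Finset V → M) (t : {σ // σ ∈ S}) {_ : Fintype {s // s < t}} :
    ∑ s : {s // s < t}, φ s.1.1 = ∑ τ ∈ S.filter (fun τ => τ ⊂ t.1), φ τ := by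
  refine Finset.sum_bij (fun s _ => s.1.1) ?_ ?_ ?_ ?_
  · intro s _
    exact Finset.mem_filter.mpr ⟨s.1.2, s.2⟩
  · intro s _ s' _ h
    exact Subtype.ext (Subtype.ext h)
  · intro τ hτ
    have := Finset.mem_filter.mp hτ
    exact ⟨⟨⟨τ, this.1⟩, this.2⟩, Finset.mem_univ _, rfl⟩
  · intros; rfl

/-- By induction, (x-1)f([0,t)) is the sum over all faces of the cube t, including ∅, minus the term
of t itself. That sum has no coefficients up to degree n/2, whereas the removed term `cubeG n` lives
only there, so truncation returns it. -/
theorem g_eq_rankG {S : Finset (Finset V)} (hS : K.IsLowerFaces S)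
    (t : {σ // σ ∈ S}) : Toric.g t = rankG (faceRank t.1) := by
  induction t using WellFoundedLT.induction with
  | ind t ih =>
    rw [Toric.g]
    split_ifs with hmin
    · have : t.1 = ∅ := by
        have h0 : ∅ ∈ S := hS.2 _ t.2 _ K.empty_mem (Finset.empty_subset _)
        exact Finset.subset_empty.mp (hmin (b := ⟨∅, h0⟩) (Finset.empty_subset t.1))
      rw [this, faceRank_empty, rankG]
    · have hne : t.1.Nonempty := Finset.nonempty_of_ne_empty fun h => hmin fun s _ => by
        show t.1 ⊆ s.1
        rw [h]; exact Finset.empty_subset _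
      have htK := hS.1 t.2
      obtain ⟨n, e, he⟩ := exists_isCubeChart htK hne
      have hr : faceRank t.1 = n + 1 := faceRank_of_equiv e
      simp only [rk_eq_faceRank hS, hr, Nat.add_sub_cancel]
      rw [rankG]
      refine gTrunc_eq (H := shellSum (1 - X) X n 0 0) ?_ (natDegree_cubeG_le n)
        (coeff_shellSum_eq_zero n)
      rw [Finset.sum_congr rfl fun s _ => by rw [ih s.1 s.2],
        ← umbral_cubeG, ← he.sum_rankG]
      refine (congrArg ((X - 1) * ·) (sum_subtype_eq
        (fun τ => rankG (faceRank τ) * (X - 1) ^ (n - faceRank τ)) t)).trans ?_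
      have hsplit : S.filter (fun τ => τ ⊂ t.1) = insert ∅
          ((K.faces.filter (fun τ => τ ⊆ t.1 ∧ τ.Nonempty)).erase t.1) := by
        ext τ
        simp only [Finset.mem_filter, Finset.mem_insert, Finset.mem_erase]
        constructor
        · rintro ⟨h1, h2⟩
          rcases τ.eq_empty_or_nonempty with h | h
          · exact Or.inl h
          · exact Or.inr ⟨h2.ne, hS.1 h1, h2.subset, h⟩
        · rintro (rfl | ⟨h1, h2, h3, h4⟩)
          · exact ⟨hS.2 _ t.2 _ K.empty_mem (Finset.empty_subset _), hne.empty_ssubset⟩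
          · exact ⟨hS.2 _ t.2 _ h2 h3, h3.ssubset_of_ne h1⟩
      have hmem : t.1 ∈ K.faces.filter (fun τ => τ ⊆ t.1 ∧ τ.Nonempty) :=
        Finset.mem_filter.mpr ⟨htK, subset_rfl, hne⟩
      rw [hsplit, Finset.sum_insert (by simp), ← Finset.sum_erase_add _ _ hmem, hr,
        faceRank_empty, Nat.sub_self, pow_zero, mul_one, mul_add, Finset.mul_sum, rankG]
      have : ∀ τ ∈ (K.faces.filter (fun τ => τ ⊆ t.1 ∧ τ.Nonempty)).erase t.1,
          (X - 1) * (rankG (faceRank τ) * (X - 1) ^ (n - faceRank τ)) =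
          rankG (faceRank τ) * (X - 1) ^ (n + 1 - faceRank τ) := by
        intro τ hτ
        obtain ⟨h1, h2⟩ := Finset.mem_erase.mp hτ
        obtain ⟨h2, h3, h4⟩ := Finset.mem_filter.mp h2
        have := faceRank_lt htK h2 (h3.ssubset_of_ne h1)
        rw [hr] at this
        have e1 : n + 1 - faceRank τ = (n - faceRank τ) + 1 := by omega
        rw [e1]
        ring
      rw [Finset.sum_congr rfl this, rankG, Nat.sub_zero]
      ring

theorem f_eq_sum {S : Finset (Finset V)} (hS : K.IsLowerFaces S) (d : ℕ)
    (hd : ∀ σ ∈ S, faceRank σ ≤ d) (hd' : ∃ σ ∈ S, faceRank σ = d) :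
    Toric.f {σ // σ ∈ S} = ∑ τ ∈ S, rankG (faceRank τ) * (X - 1) ^ (d - faceRank τ) := by
  have hsup : Finset.univ.sup (fun s : {σ // σ ∈ S} => Toric.rk s) = d := by
    apply le_antisymm
    · refine Finset.sup_le fun s _ => ?_
      rw [rk_eq_faceRank hS]
      exact hd _ s.2
    · obtain ⟨σ, h1, h2⟩ := hd'
      have := Finset.le_sup (f := fun s : {σ // σ ∈ S} => Toric.rk s)
        (Finset.mem_univ ⟨σ, h1⟩)
      simp only [rk_eq_faceRank hS, h2] at this
      simpa only [rk_eq_faceRank hS] using this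
  rw [Toric.f, hsup]
  simp only [rk_eq_faceRank hS, g_eq_rankG hS]
  exact Finset.sum_coe_sort S fun τ => rankG (faceRank τ) * (X - 1) ^ (d - faceRank τ)

end CubicalComplex

-- Facets of a cube and antipodal pairs

section Facets

/-- The partial assignment that fixes only the coordinate `k`. -/
def facetAssignment {n : ℕ} (k : Fin n) (b : Bool) : Fin n → Option Bool :=
  fun l => if l = k then some b else none

variable {n : ℕ}

theorem facetAssignment_injective {k k' : Fin n} {b b' : Bool}
    (h : facetAssignment k b = facetAssignment k' b') : k = k' ∧ b = b' := by
  have h1 := congrFun h k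
  unfold facetAssignment at h1
  by_cases hk : k = k'
  · subst hk
    simpa using h1
  · simp [hk] at h1

theorem eq_facetAssignment {p : Fin n → Option Bool} (hp : freeCount p + 1 = n) :
    ∃ k b, p = facetAssignment k b := by
  have h1 := Finset.card_filter_add_card_filter_not (s := (Finset.univ : Finset (Fin n)))
    (fun k => p k = none)
  rw [Finset.card_fin, ← freeCount] at h1
  have h2 : (Finset.univ.filter fun k => ¬ p k = none).card = 1 := by omega
  obtain ⟨k, hk⟩ := Finset.card_eq_one.mp h2
  have h3 : ∀ l, p l ≠ none ↔ l = k := fun l => by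
    have := congrArg (l ∈ ·) hk
    simpa using this
  obtain ⟨b, hb⟩ := Option.ne_none_iff_exists'.mp ((h3 k).mpr rfl)
  refine ⟨k, b, funext fun l => ?_⟩
  unfold facetAssignment
  split_ifs with hl
  · rw [hl, hb]
  · by_contra h
    exact hl ((h3 l).mp h)

theorem freeCount_facetAssignment (k : Fin n) (b : Bool) :
    freeCount (facetAssignment k b) + 1 = n := by
  have h1 := Finset.card_filter_add_card_filter_not (s := (Finset.univ : Finset (Fin n)))
    (fun l => facetAssignment k b l = none)
  rw [Finset.card_fin, ← freeCount] at h1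
  have : (Finset.univ.filter fun l => ¬ facetAssignment k b l = none) = {k} := by
    ext l
    simp [facetAssignment]
  rw [this, Finset.card_singleton] at h1
  exact h1

variable {V : Type*} [DecidableEq V] {σ : Finset V} (e : (Fin n → Bool) ≃ {v // v ∈ σ})

theorem cubeFace_subset_facet {p : Fin n → Option Bool} {k : Fin n} {b : Bool} :
    cubeFace e p ⊆ cubeFace e (facetAssignment k b) ↔ p k = some b := by
  rw [cubeFace_subset_cubeFace]
  constructor
  · intro h
    simpa [facetAssignment, eq_comm] using h k
  · intro h l
    unfold facetAssignment
    split_ifs with hl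
    · rw [hl, h]; exact Or.inr rfl
    · exact Or.inl rfl

theorem facet_inter_eq_empty {k k' : Fin n} {b b' : Bool} :
    cubeFace e (facetAssignment k b) ∩ cubeFace e (facetAssignment k' b') = ∅ ↔
      k = k' ∧ b' = !b := by
  have hmem : ∀ k b v, (e v : V) ∈ cubeFace e (facetAssignment k b) ↔ v k = b := by
    intro k b v
    rw [mem_cubeFace]
    constructor
    · intro h
      simpa [facetAssignment, eq_comm] using h k
    · intro h l
      unfold facetAssignment
      split_ifs with hl
      · rw [hl, h]; exact Or.inr rfl
      · exact Or.inl rfl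
  constructor
  · intro h
    by_contra hne
    -- Facets that are not antipodal share this vertex: give coordinate k the value b and every
    -- other coordinate the value b'.
    have hx : (e fun l => if l = k then b else b' : V) ∈
        cubeFace e (facetAssignment k b) ∩ cubeFace e (facetAssignment k' b') := by
      rw [Finset.mem_inter, hmem, hmem]
      refine ⟨if_pos rfl, ?_⟩
      by_cases hk : k' = k
      · simp only [hk, if_true]
        by_contra hb
        exact hne ⟨hk.symm, by cases b <;> cases b' <;> simp_all⟩
      · simp [hk]
    rw [h] at hx
    simp at hx
  · rintro ⟨rfl, rfl⟩
    rw [Finset.eq_empty_iff_forall_notMem]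
    intro x hx
    obtain ⟨h1, h2⟩ := Finset.mem_inter.mp hx
    obtain ⟨v, _, rfl⟩ := Finset.mem_image.mp h1
    rw [hmem] at h1 h2
    rw [h1] at h2
    cases b <;> simp at h2

end Facets

/-- With a = 1-x and c = 2(x-1), the numbers c, c + a, c + 2a are 2(x-1), x-1, 0: the factors for
two, one and no new facets in a direction. -/
theorem umbral_cubeG_shell (i j m : ℕ) (hi : 0 < i) :
    umbral cubeG (X ^ j * (X + C (X - 1)) ^ i * (X + C (2 * (X - 1))) ^ m) =
      shellSum (1 - X) X (m + i + j) i j := by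
  -- The added functional supplies the empty face: evaluation at 1 - x sends X + 2(x-1) to x-1, so
  -- the powers acquire the term (x-1)^(n+1). It vanishes on multiples of X + (x-1), hence when i >
  -- 0.
  set Λ : ℤ[X][X] →ₗ[ℤ[X]] ℤ[X] :=
    umbral cubeG + (X - 1 : ℤ[X]) • Polynomial.leval (1 - X : ℤ[X]) with hΛ
  have h := linearMap_eq_shellSum Λ (1 - X) X (2 * (X - 1)) (fun n => ?_) i j m
  · have e1 : (2 * (X - 1) + 2 * (1 - X) : ℤ[X]) = 0 := by ring
    have e2 : (2 * (X - 1) + (1 - X) : ℤ[X]) = X - 1 := by ring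
    rw [e1, e2, C_0, add_zero] at h
    rw [← h, hΛ, LinearMap.add_apply, LinearMap.smul_apply, Polynomial.leval_apply]
    have : (X + C (X - 1 : ℤ[X])).eval (1 - X) = 0 := by simp
    rw [eval_mul, eval_mul, eval_pow (n := i), this, zero_pow hi.ne', mul_zero, zero_mul,
      smul_zero, add_zero]
  · rw [hΛ, LinearMap.add_apply, LinearMap.smul_apply, Polynomial.leval_apply, ← umbral_cubeG,
      eval_pow]
    congr 1
    have : (X + C (2 * (X - 1) : ℤ[X])).eval (1 - X) = X - 1 := by simp; ring
    rw [this, smul_eq_mul, pow_succ']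

theorem prod_by_card {M : Type*} [CommMonoid M] {n i j : ℕ} (a : Fin n → ℕ) (P : ℕ → M)
    (ha : ∀ k, a k ≤ 2) (h0 : ∑ k, (if a k = 0 then 1 else 0) = j)
    (h1 : ∑ k, (if a k = 1 then 1 else 0) = i) :
    ∃ m, m + i + j = n ∧ ∏ k, P (a k) = P 0 ^ j * P 1 ^ i * P 2 ^ m := by
  refine ⟨∑ k, (if a k = 2 then 1 else 0), ?_, ?_⟩
  · rw [← h0, ← h1, ← Finset.sum_add_distrib, ← Finset.sum_add_distrib]
    have : ∀ k ∈ (Finset.univ : Finset (Fin n)), ((if a k = 2 then 1 else 0) +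
        (if a k = 1 then 1 else 0) + if a k = 0 then 1 else 0) = 1 := by
      intro k _
      have := ha k
      interval_cases a k <;> rfl
    rw [Finset.sum_congr rfl this]
    simp
  · rw [← h0, ← h1, ← Finset.prod_pow_eq_pow_sum, ← Finset.prod_pow_eq_pow_sum,
      ← Finset.prod_pow_eq_pow_sum, ← Finset.prod_mul_distrib, ← Finset.prod_mul_distrib]
    refine Finset.prod_congr rfl fun k _ => ?_
    have := ha k
    interval_cases a k <;> simp

-- The contribution of a shelling component

namespace CubicalComplex

variable {V : Type*} [DecidableEq V] {K : CubicalComplex V} {d r : ℕ} {F : Fin r → Finset V}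

theorem isLowerFaces_upTo (t : Fin r) : K.IsLowerFaces (K.upTo F t) := by
  refine ⟨Finset.filter_subset _ _, fun σ hσ τ hτ h => ?_⟩
  obtain ⟨_, s, hs, hs'⟩ := Finset.mem_filter.mp hσ
  exact Finset.mem_filter.mpr ⟨hτ, s, hs, h.trans hs'⟩

theorem isLowerFaces_before (t : Fin r) : K.IsLowerFaces (K.before F t) := by
  refine ⟨Finset.filter_subset _ _, fun σ hσ τ hτ h => ?_⟩
  obtain ⟨_, s, hs, hs'⟩ := Finset.mem_filter.mp hσ
  exact Finset.mem_filter.mpr ⟨hτ, s, hs, h.trans hs'⟩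

theorem IsShelling.facet_mem (hF : K.IsShelling d F) (t : Fin r) : F t ∈ K.faces :=
  ((hF.1.2 (F t)).mp ⟨t, rfl⟩).1

theorem IsShelling.faceRank_le (hF : K.IsShelling d F) {σ : Finset V} (hσ : σ ∈ K.faces)
    (s : Fin r) (h : σ ⊆ F s) : faceRank σ ≤ d := by
  rw [← hF.2.1 s]
  rcases h.eq_or_ssubset with rfl | h
  · exact le_rfl
  · exact (faceRank_lt (hF.facet_mem s) hσ h).le

theorem IsShelling.f_upTo (hF : K.IsShelling d F) (t : Fin r) :
    Toric.f {σ // σ ∈ K.upTo F t} =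
      ∑ τ ∈ K.upTo F t, rankG (faceRank τ) * (X - 1) ^ (d - faceRank τ) := by
  refine f_eq_sum (isLowerFaces_upTo t) d (fun σ hσ => ?_)
    ⟨F t, Finset.mem_filter.mpr ⟨hF.facet_mem t, t, le_rfl, subset_rfl⟩, hF.2.1 t⟩
  obtain ⟨h1, s, _, h2⟩ := Finset.mem_filter.mp hσ
  exact hF.faceRank_le h1 s h2

theorem IsShelling.f_before (hF : K.IsShelling d F) (t : Fin r) :
    Toric.f {σ // σ ∈ K.before F t} =
      ∑ τ ∈ K.before F t, rankG (faceRank τ) * (X - 1) ^ (d - faceRank τ) := by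
  by_cases ht : 0 < t.val
  · refine f_eq_sum (isLowerFaces_before t) d (fun σ hσ => ?_) ?_
    · obtain ⟨h1, s, _, h2⟩ := Finset.mem_filter.mp hσ
      exact hF.faceRank_le h1 s h2
    · refine ⟨F ⟨0, t.pos⟩, Finset.mem_filter.mpr ⟨hF.facet_mem _, ⟨0, t.pos⟩, ?_, subset_rfl⟩,
        hF.2.1 _⟩
      exact Fin.lt_def.mpr ht
  · have : K.before F t = ∅ := by
      refine Finset.filter_eq_empty_iff.mpr fun σ _ => ?_
      rintro ⟨s, hs, _⟩
      exact ht (Nat.zero_lt_of_lt (Fin.lt_def.mp hs))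
    rw [this]
    simp [Toric.f]

/-- Each face has the same weight in both toric polynomials: g depends only on its rank, and the top
rank is d before and after. Only the new faces survive; for the first facet the old sum is empty. -/
theorem IsShelling.contribution_eq_sum (hF : K.IsShelling d F) (t : Fin r) :
    K.contribution F t = ∑ τ ∈ K.faces.filter (fun τ => τ ⊆ F t ∧ τ ∉ K.before F t),
      rankG (faceRank τ) * (X - 1) ^ (d - faceRank τ) := by
  have hsub : K.before F t ⊆ K.upTo F t := by
    intro σ hσ
    obtain ⟨h1, s, h2, h3⟩ := Finset.mem_filter.mp hσ
    exact Finset.mem_filter.mpr ⟨h1, s, h2.le, h3⟩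
  rw [contribution, hF.f_upTo, hF.f_before, ← Finset.sum_sdiff_eq_sub hsub]
  refine Finset.sum_congr ?_ fun _ _ => rfl
  ext τ
  simp only [Finset.mem_sdiff, Finset.mem_filter, upTo]
  constructor
  · rintro ⟨⟨h1, s, h2, h3⟩, h4⟩
    refine ⟨h1, ?_, h4⟩
    rcases h2.eq_or_lt with rfl | h2
    · exact h3
    · exact absurd (Finset.mem_filter.mpr ⟨h1, s, h2, h3⟩) h4
  · rintro ⟨h1, h2, h3⟩
    exact ⟨⟨h1, t, le_rfl, h2⟩, h3⟩

theorem before_eq_empty {t : Fin r} (ht : t.val = 0) : K.before F t = ∅ := by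
  refine Finset.filter_eq_empty_iff.mpr fun σ _ => ?_
  rintro ⟨s, hs, _⟩
  have := Fin.lt_def.mp hs
  omega

theorem HasType.pos {t : Fin r} {i j : ℕ} (hF : K.IsShelling d F) (h : K.HasType d F t i j)
    (hj : j < d - 1) (ht : 0 < t.val) : 0 < i := by
  obtain ⟨_, i', j', h', h0⟩ := hF.2.2 t ht
  have e1 : i' = i := h'.1.symm.trans h.1
  have e2 : 2 * j' = 2 * j := h'.2.symm.trans h.2
  by_contra hi
  have := h0 (by omega)
  omega

theorem HasType.eq_zero {t : Fin r} {i j : ℕ} (h : K.HasType d F t i j) (ht : t.val = 0) :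
    i = 0 ∧ j = 0 := by
  have h0 : K.oldRidges d F t = ∅ := by rw [oldRidges, before_eq_empty ht, Finset.filter_empty]
  obtain ⟨h1, h2⟩ := h
  rw [pairedRidges, h0] at h2
  rw [h0] at h1
  simp at h1 h2
  omega

theorem IsShelling.contribution_of_eq_zero (hF : K.IsShelling d F) {t : Fin r} (ht : t.val = 0)
    (hd : 0 < d) : K.contribution F t = shellPoly d 0 0 := by
  have hne : (F t).Nonempty := Finset.nonempty_of_ne_empty fun h => by
    have := hF.2.1 t
    rw [h, faceRank_empty] at this
    omega
  obtain ⟨n, e, he⟩ := exists_isCubeChart (hF.facet_mem t) hne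
  obtain rfl : d = n + 1 := (hF.2.1 t).symm.trans (faceRank_of_equiv e)
  rw [hF.contribution_eq_sum, shellPoly_succ, ← umbral_cubeG, ← he.sum_rankG]
  have : K.faces.filter (fun τ => τ ⊆ F t ∧ τ ∉ K.before F t) =
      insert ∅ (K.faces.filter (fun τ => τ ⊆ F t ∧ τ.Nonempty)) := by
    ext τ
    simp only [before_eq_empty ht, Finset.notMem_empty, not_false_eq_true, and_true,
      Finset.mem_filter, Finset.mem_insert]
    constructor
    · rintro ⟨h1, h2⟩
      rcases τ.eq_empty_or_nonempty with h | h
      · exact Or.inl h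
      · exact Or.inr ⟨h1, h2, h⟩
    · rintro (rfl | ⟨h1, h2, _⟩)
      · exact ⟨K.empty_mem, Finset.empty_subset _⟩
      · exact ⟨h1, h2⟩
  rw [this, Finset.sum_insert (by simp), faceRank_empty, rankG, Nat.sub_zero, one_mul, add_comm]

theorem oldRidges_eq_image {n : ℕ} {t : Fin r} {e : (Fin n → Bool) ≃ {v // v ∈ F t}}
    (he : K.IsCubeChart (F t) e) (hn : 0 < n) :
    K.oldRidges (n + 1) F t = (Finset.univ.filter fun q : Fin n × Bool =>
      cubeFace e (facetAssignment q.1 q.2) ∈ K.before F t).image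
        fun q => cubeFace e (facetAssignment q.1 q.2) := by
  ext G
  simp only [oldRidges, Finset.mem_filter, Finset.mem_image, Finset.mem_univ, true_and]
  constructor
  · rintro ⟨h1, h2, h3⟩
    have hne : G.Nonempty := Finset.nonempty_of_ne_empty fun h => by
      rw [h, faceRank_empty] at h3
      omega
    obtain ⟨p, rfl⟩ := he.exists_cubeFace (Finset.mem_filter.mp h1).1 h2 hne
    rw [faceRank_cubeFace] at h3
    obtain ⟨k, b, rfl⟩ := eq_facetAssignment (p := p) (by omega)
    exact ⟨(k, b), h1, rfl⟩
  · rintro ⟨⟨k, b⟩, h1, rfl⟩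
    refine ⟨h1, cubeFace_subset e _, ?_⟩
    rw [faceRank_cubeFace, freeCount_facetAssignment]

theorem pairedRidges_eq_image {n : ℕ} {t : Fin r} {e : (Fin n → Bool) ≃ {v // v ∈ F t}}
    (he : K.IsCubeChart (F t) e) (hn : 0 < n) :
    K.pairedRidges (n + 1) F t = (Finset.univ.filter fun q : Fin n × Bool =>
      cubeFace e (facetAssignment q.1 q.2) ∈ K.before F t ∧
      cubeFace e (facetAssignment q.1 (!q.2)) ∈ K.before F t).image
        fun q => cubeFace e (facetAssignment q.1 q.2) := by
  ext G
  simp only [pairedRidges, oldRidges_eq_image he hn, Finset.mem_filter, Finset.mem_image,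
    Finset.mem_univ, true_and]
  constructor
  · rintro ⟨⟨⟨k, b⟩, h1, rfl⟩, _, ⟨⟨k', b'⟩, h2, rfl⟩, _, h3⟩
    obtain ⟨rfl, rfl⟩ := (facet_inter_eq_empty e).mp h3
    exact ⟨(k, b), ⟨h1, h2⟩, rfl⟩
  · rintro ⟨⟨k, b⟩, ⟨h1, h2⟩, rfl⟩
    refine ⟨⟨(k, b), h1, rfl⟩, _, ⟨(k, !b), h2, rfl⟩, fun h => ?_,
      (facet_inter_eq_empty e).mpr ⟨rfl, rfl⟩⟩
    have := (facetAssignment_injective (cubeFace_injective e h)).2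
    cases b <;> simp at this

theorem IsShelling.contribution_of_pos (hF : K.IsShelling d F) {t : Fin r} (ht : 0 < t.val)
    {i j : ℕ} (hT : K.HasType d F t i j) (hj : j < d - 1) :
    i + j ≤ d - 1 ∧ K.contribution F t = shellPoly d i j := by
  classical
  have hi := hT.pos hF hj ht
  have hne : (F t).Nonempty := Finset.nonempty_of_ne_empty fun h => by
    have := hF.2.1 t
    rw [h, faceRank_empty] at this
    omega
  obtain ⟨n, e, he⟩ := exists_isCubeChart (hF.facet_mem t) hne
  obtain rfl : d = n + 1 := (hF.2.1 t).symm.trans (faceRank_of_equiv e)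
  have hn : 0 < n := by omega
  set o : Fin n → Bool → Prop := fun k b => cubeFace e (facetAssignment k b) ∈ K.before F t with ho
  have hinj : Function.Injective fun q : Fin n × Bool => cubeFace e (facetAssignment q.1 q.2) :=
    fun q q' h => Prod.ext_iff.mpr (facetAssignment_injective (cubeFace_injective e h))
  have hold := oldRidges_eq_image he hn
  have hpair := pairedRidges_eq_image he hn
  -- The number of new facets in direction k: 0 for an old antipodal pair, 1 for an unpaired old
  -- facet, 2 otherwise.
  set a : Fin n → ℕ := fun k => (Finset.univ.filter fun b => ¬ o k b).card with ha
  have ha' : ∀ k, a k = (if o k true then 0 else 1) + (if o k false then 0 else 1) := by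
    intro k
    simp only [ha, Finset.card_filter, Fintype.sum_bool, ite_not]
  have h0 : ∑ k, (if a k = 0 then 1 else 0) = j := by
    have h2 := hT.2
    rw [hpair, Finset.card_image_of_injective _ hinj, Finset.card_filter,
      Fintype.sum_prod_type] at h2
    have : 2 * ∑ k, (if a k = 0 then 1 else 0) = 2 * j := by
      rw [← h2, Finset.mul_sum]
      refine Finset.sum_congr rfl fun k _ => ?_
      change _ = ∑ b, if o k b ∧ o k (!b) then 1 else 0
      rw [ha']
      by_cases h1 : o k true <;> by_cases h2 : o k false <;> simp [h1, h2]
    omega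
  have h1 : ∑ k, (if a k = 1 then 1 else 0) = i := by
    have h1 := hT.1
    rw [hpair, hold, ← Finset.image_sdiff _ _ hinj, Finset.card_image_of_injective _ hinj,
      ← Finset.filter_and_not, Finset.card_filter, Fintype.sum_prod_type] at h1
    rw [← h1]
    refine Finset.sum_congr rfl fun k _ => ?_
    change _ = ∑ b, if o k b ∧ ¬ (o k b ∧ o k (!b)) then 1 else 0
    rw [ha']
    by_cases h1 : o k true <;> by_cases h2 : o k false <;> simp [h1, h2]
  obtain ⟨m, hm, hprod⟩ := prod_by_card a (fun l => X + C ((l : ℤ[X]) * (X - 1)))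
    (fun k => by rw [ha']; split_ifs <;> omega) h0 h1
  have hnew : K.faces.filter (fun τ => τ ⊆ F t ∧ τ ∉ K.before F t) =
      (Fintype.piFinset fun k => Finset.insertNone (Finset.univ.filter fun b => ¬ o k b)).image
        (cubeFace e) := by
    ext τ
    simp only [Finset.mem_filter, Finset.mem_image, Fintype.mem_piFinset, Finset.mem_insertNone,
      Finset.mem_univ, true_and]
    constructor
    · rintro ⟨h1, h2, h3⟩
      -- The empty face is old because an earlier facet exists.
      have hτ : τ.Nonempty := Finset.nonempty_of_ne_empty fun h => h3 <|
        h ▸ Finset.mem_filter.mpr ⟨K.empty_mem, ⟨0, t.pos⟩, Fin.lt_def.mpr ht,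
          Finset.empty_subset _⟩
      obtain ⟨p, rfl⟩ := he.exists_cubeFace h1 h2 hτ
      refine ⟨p, fun k b hb hk => h3 ?_, rfl⟩
      exact (isLowerFaces_before t).2 _ hk _ h1 ((cubeFace_subset_facet e).mpr hb)
    · rintro ⟨p, hp, rfl⟩
      refine ⟨he.cubeFace_mem p, cubeFace_subset e p, fun h => ?_⟩
      -- The shelling condition: an old face lies in an old ridge, so it fixes some coordinate to a
      -- forbidden value.
      obtain ⟨G, hG, hpG⟩ := (hF.2.2 t ht).1 _ h (cubeFace_subset e p)
      rw [hold] at hG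
      obtain ⟨⟨k, b⟩, hk, rfl⟩ := Finset.mem_image.mp hG
      exact hp k b ((cubeFace_subset_facet e).mp hpG) (Finset.mem_filter.mp hk).2
  have hsum := sum_piFinset_freeCount cubeG (X - 1) fun k => Finset.univ.filter fun b => ¬ o k b
  refine ⟨by omega, ?_⟩
  rw [hF.contribution_eq_sum, hnew, Finset.sum_image fun _ _ _ _ h => cubeFace_injective e h,
    shellPoly_succ]
  simp only [faceRank_cubeFace, Nat.add_sub_add_right]
  refine hsum.trans ?_
  rw [hprod, ← hm, ← umbral_cubeG_shell i j m hi]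
  simp

/-- The contribution of a shelling component of type `(i, j)`. -/
theorem IsShelling.contribution_eq_shellPoly (hF : K.IsShelling d F) (t : Fin r) {i j : ℕ}
    (hT : K.HasType d F t i j) (hj : j < d - 1) :
    i + j ≤ d - 1 ∧ (i = 0 → j = 0) ∧ K.contribution F t = shellPoly d i j := by
  rcases Nat.eq_zero_or_pos t.val with ht | ht
  · obtain ⟨rfl, rfl⟩ := hT.eq_zero ht
    exact ⟨by omega, fun _ => rfl, hF.contribution_of_eq_zero ht (by omega)⟩
  · obtain ⟨h1, h2⟩ := hF.contribution_of_pos ht hT hj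
    have := hT.pos hF hj ht
    exact ⟨h1, by omega, h2⟩

end CubicalComplex

-- Products of position-dependent weights

section PosProd

variable {α β M : Type*} [CommMonoid M]

/-- The product of the values `g k a` over the entries `a` of a list, where `k` is the position of
the entry and positions start with `p`. -/
def posProd (g : ℕ → α → M) : ℕ → List α → M
  | _, [] => 1
  | p, a :: l => g p a * posProd g (p + 1) l

theorem posProd_append (g : ℕ → α → M) (p : ℕ) (l l' : List α) :
    posProd g p (l ++ l') = posProd g p l * posProd g (p + l.length) l' := by
  induction l generalizing p with
  | nil => simp [posProd]
  | cons a l ih =>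
    simp only [List.cons_append, posProd, ih, List.length_cons, mul_assoc]
    congr 3
    omega

theorem posProd_map (g : ℕ → β → M) (φ : α → β) (p : ℕ) (l : List α) :
    posProd g p (l.map φ) = posProd (fun k a => g k (φ a)) p l := by
  induction l generalizing p with
  | nil => rfl
  | cons a l ih => simp only [List.map_cons, posProd, ih]

theorem posProd_congr {g g' : ℕ → α → M} {p : ℕ} {l : List α}
    (h : ∀ k a, a ∈ l → g k a = g' k a) : posProd g p l = posProd g' p l := by
  induction l generalizing p with
  | nil => rfl
  | cons a l ih =>
    rw [posProd, posProd, h _ _ List.mem_cons_self,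
      ih fun k b hb => h k b (List.mem_cons_of_mem _ hb)]

theorem prod_toFinset_idxOf [DecidableEq α] [BEq α] [LawfulBEq α] (g : ℕ → α → M) (p : ℕ) {l : List α} (hl : l.Nodup) :
    ∏ v ∈ l.toFinset, g (l.idxOf v + p) v = posProd g p l := by
  induction l generalizing p with
  | nil => rfl
  | cons a l ih =>
    obtain ⟨h1, h2⟩ := List.nodup_cons.mp hl
    rw [List.toFinset_cons, Finset.prod_insert (by simpa using h1), posProd, ← ih _ h2]
    congr 1
    · simp
    · refine Finset.prod_congr rfl fun v hv => ?_
      have hne : a ≠ v := fun h => h1 (h ▸ List.mem_toFinset.mp hv)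
      rw [List.idxOf_cons_ne _ hne]
      congr 1
      omega

end PosProd

-- Plane trees, their words and their vertex types

namespace PlaneTree

theorem forest_induction {P : List PlaneTree → Prop} (nil : P [])
    (cons : ∀ cs ts, P cs → P ts → P (node cs :: ts)) (ts : List PlaneTree) : P ts :=
  PlaneTree.rec_1 (motive_1 := fun T => ∀ cs, T = node cs → P cs) (motive_2 := P)
    (fun _ h _ h' => by cases h'; exact h) nil
    (fun T ts h h' => by cases T with | node cs => exact cons cs ts (h cs rfl) h') ts

theorem children_induction {Q : List PlaneTree → Prop}
    (h : ∀ ts, (∀ cs, node cs ∈ ts → Q cs) → Q ts) (ts : List PlaneTree) : Q ts := by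
  have key : ∀ ts : List PlaneTree, ∀ cs, node cs ∈ ts → Q cs := by
    refine forest_induction (by simp) fun cs ts h1 h2 cs' hcs => ?_
    rcases List.mem_cons.mp hcs with h' | h'
    · cases h'
      exact h _ h1
    · exact h2 _ h'
  exact h ts (key ts)

/-- The vertices of a forest in postorder, where each vertex is recorded by two truth values: whether
it is a leaf, and whether it is a leftmost child. The flag tells whether the root of the first tree
is considered as a leftmost child. -/
def forestWord (b : Bool) : List PlaneTree → List (Bool × Bool)
  | [] => []
  | node cs :: ts => forestWord true cs ++ (cs.isEmpty, b) :: forestWord false ts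

theorem forestWord_append (b : Bool) (ts cs : List PlaneTree) :
    forestWord b (ts ++ [node cs]) =
      forestWord b ts ++ forestWord true cs ++ [(cs.isEmpty, b && ts.isEmpty)] := by
  induction ts generalizing b with
  | nil => simp [forestWord]
  | cons t ts ih =>
    cases t with | node cs' =>
    simp [forestWord, ih]

/-! ### Encoding plane trees by paths -/

/-- One step of the machine that rebuilds a forest from its word. -/
def step : List (List PlaneTree) → Bool × Bool → List (List PlaneTree)
  | S, (true, true) => [node []] :: S
  | l :: S, (true, false) => (l ++ [node []]) :: S
  | l :: S, (false, true) => [node l] :: S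
  | l :: l' :: S, (false, false) => (l' ++ [node l]) :: S
  | S, _ => S

/-- In postorder the children of a vertex are complete when the vertex itself is read, so a stack of
unfinished sibling lists suffices. A leaf opens or extends a list; an inner vertex absorbs the top
list and opens or extends another. -/
theorem foldl_step (ts : List PlaneTree) :
    (∀ S, ts ≠ [] → (forestWord true ts).foldl step S = ts :: S) ∧
    (∀ l S, (forestWord false ts).foldl step (l :: S) = (l ++ ts) :: S) := by
  induction ts using forest_induction with
  | nil => simp [forestWord]
  | cons cs ts h1 h2 =>
    rcases cs with _ | ⟨c, cs⟩
    · refine ⟨fun S _ => ?_, fun l S => ?_⟩ <;>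
        simp [forestWord, step, h2.2]
    · refine ⟨fun S _ => ?_, fun l S => ?_⟩ <;>
        simp only [forestWord, List.foldl_append, List.foldl_cons, h1.1 _ (List.cons_ne_nil _ _)]
      · simp [step, h2.2]
      · simp [step, h2.2]

theorem forestWord_true_injective : Function.Injective (forestWord true) := by
  have h0 : ∀ ts, forestWord true ts = [] → ts = [] := by
    intro ts h
    rcases ts with _ | ⟨⟨cs⟩, ts⟩
    · rfl
    · simp [forestWord] at h
  intro ts ts' h
  by_cases hts : ts = []
  · subst hts
    exact (h0 _ (h.symm.trans (by simp [forestWord]))).symm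
  · by_cases hts' : ts' = []
    · subst hts'
      exact h0 _ (h.trans (by simp [forestWord]))
    · have h1 := (foldl_step ts).1 [] hts
      rw [h, (foldl_step ts').1 [] hts'] at h1
      exact (List.cons.inj h1).1.symm

/-- Paths from height `h` to height `0` with up steps `(true, true)`, down steps `(false, false)` and
two kinds of level steps. -/
def IsPath : ℕ → List (Bool × Bool) → Prop
  | h, [] => h = 0
  | h, (true, true) :: w => IsPath (h + 1) w
  | h, (true, false) :: w => IsPath h w
  | h, (false, true) :: w => IsPath h w
  | 0, (false, false) :: _ => False
  | h + 1, (false, false) :: w => IsPath h w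

/-- The two halves are proved together: a nonempty first-child forest opens with a new stack entry,
whose up step is split off, while a later-child forest returns to its starting height. A later child
that is not a leaf takes the down step matching the up step of its own children. -/
theorem isPath_forestWord (ts : List PlaneTree) :
    (∀ h w, IsPath h w → ts ≠ [] →
      ∃ w', forestWord true ts ++ w = (true, true) :: w' ∧ IsPath h w') ∧
    (∀ h w, IsPath h w → IsPath h (forestWord false ts ++ w)) := by
  induction ts using forest_induction with
  | nil => simp [forestWord]
  | cons cs ts h1 h2 =>
    rcases cs with _ | ⟨c, cs⟩
    · refine ⟨fun h w hw _ => ⟨forestWord false ts ++ w, by simp [forestWord], h2.2 h w hw⟩,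
        fun h w hw => ?_⟩
      simpa [forestWord, IsPath] using h2.2 h w hw
    · have hne : (c :: cs) ≠ [] := List.cons_ne_nil _ _
      refine ⟨fun h w hw _ => ?_, fun h w hw => ?_⟩
      · obtain ⟨w', hw', hp⟩ := h1.1 h ((false, true) :: (forestWord false ts ++ w))
          (by simpa only [IsPath] using h2.2 h w hw) hne
        exact ⟨w', by simpa [forestWord] using hw', hp⟩
      · obtain ⟨w', hw', hp⟩ := h1.1 (h + 1) ((false, false) :: (forestWord false ts ++ w))
          (by simpa only [IsPath] using h2.2 h w hw) hne
        have : forestWord false (node (c :: cs) :: ts) ++ w = (true, true) :: w' := by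
          rw [← hw']; simp [forestWord]
        rw [this, IsPath]
        exact hp

/-- The word that leads the machine to a given stack of forests. -/
def stackWord : List (List PlaneTree) → List (Bool × Bool)
  | [] => []
  | l :: S => stackWord S ++ forestWord true l

/-- The stack machine never gets stuck on a path: the height is the stack size minus one, and all
entries stay nonempty. Since `stackWord` records what has been read, the invariant yields a forest
at the end. -/
theorem exists_forestWord_eq (w : List (Bool × Bool)) (h : ℕ) (hw : IsPath h w)
    (S : List (List PlaneTree)) (hS : S.length = h + 1) (hne : ∀ l ∈ S, l ≠ []) :
    ∃ ts, ts ≠ [] ∧ forestWord true ts = stackWord S ++ w := by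
  induction w generalizing h S with
  | nil =>
    rw [IsPath] at hw
    subst hw
    obtain ⟨l, rfl⟩ := List.length_eq_one_iff.mp hS
    exact ⟨l, hne l (by simp), by simp [stackWord]⟩
  | cons a w ih =>
    obtain ⟨l, S, rfl⟩ := List.exists_cons_of_length_eq_add_one hS
    have hl : l ≠ [] := hne l (by simp)
    have hS' : ∀ l ∈ S, l ≠ [] := fun l' h => hne l' (by simp [h])
    rcases a with ⟨_ | _, _ | _⟩
    · cases h with
      | zero => exact absurd hw (by simp [IsPath])
      | succ h =>
        rw [IsPath] at hw
        obtain ⟨l', S, rfl⟩ := List.exists_cons_of_length_eq_add_one (by simpa using hS)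
        have hl' : l' ≠ [] := hS' l' (by simp)
        obtain ⟨ts, h1, h2⟩ := ih h hw ((l' ++ [node l]) :: S) (by simpa using hS) (by
          intro x hx
          rcases List.mem_cons.mp hx with rfl | hx
          · simp
          · exact hS' x (by simp [hx]))
        refine ⟨ts, h1, h2.trans ?_⟩
        simp [stackWord, forestWord_append, hl, hl']
    · rw [IsPath] at hw
      obtain ⟨ts, h1, h2⟩ := ih h hw ([node l] :: S) (by simpa using hS) (by simpa using hS')
      refine ⟨ts, h1, h2.trans ?_⟩
      simp [stackWord, forestWord, hl]
    · rw [IsPath] at hw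
      obtain ⟨ts, h1, h2⟩ := ih h hw ((l ++ [node []]) :: S) (by simpa using hS)
        (by simpa using hS')
      refine ⟨ts, h1, h2.trans ?_⟩
      simp [stackWord, forestWord_append, forestWord, hl]
    · rw [IsPath] at hw
      obtain ⟨ts, h1, h2⟩ := ih (h + 1) hw ([node []] :: l :: S) (by simpa using hS)
        (by simpa [hl] using hS')
      refine ⟨ts, h1, h2.trans ?_⟩
      simp [stackWord, forestWord]

/-- The set of paths of length `n` from height `h` to height `0`. -/
def paths : ℕ → ℕ → Finset (List (Bool × Bool))
  | 0, 0 => {[]}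
  | 0, _ + 1 => ∅
  | n + 1, h =>
    (Finset.univ : Finset (Bool × Bool)).biUnion fun a => (match a, h with
      | (true, true), h => paths n (h + 1)
      | (true, false), h => paths n h
      | (false, true), h => paths n h
      | (false, false), 0 => ∅
      | (false, false), h + 1 => paths n h).image (a :: ·)

theorem mem_paths {n h : ℕ} {w : List (Bool × Bool)} :
    w ∈ paths n h ↔ IsPath h w ∧ w.length = n := by
  induction n generalizing h w with
  | zero =>
    cases h <;> rw [paths]
    · cases w <;> simp [IsPath]
    · cases w <;> simp [IsPath]
  | succ n ih =>
    rw [paths]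
    cases w with
    | nil => simp
    | cons a w =>
      rcases a with ⟨_ | _, _ | _⟩
      · cases h <;> simp [IsPath, ih]
      all_goals simp [IsPath, ih]

/-- Only the sum of the two level weights at each position matters, so the two kinds of level steps
merge into one. -/
theorem sum_paths {R : Type*} [CommRing R] (q : R) (f : ℕ → Bool × Bool → R)
    (hU : ∀ p, f p (true, true) = q) (hD : ∀ p, f p (false, false) = 1) (n h p : ℕ) :
    ∑ w ∈ paths n h, posProd f p w =
      pathSum q h ((List.range' p n).map fun k => f k (true, false) + f k (false, true)) := by
  induction n generalizing h p with
  | zero => cases h <;> simp [paths, pathSum, posProd]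
  | succ n ih =>
    have hinj : ∀ a : Bool × Bool, Function.Injective (a :: · : List (Bool × Bool) → _) :=
      fun a => List.cons_injective
    rw [paths, Finset.sum_biUnion]
    · simp only [Finset.sum_image fun _ _ _ _ h => hinj _ h, posProd, ← Finset.mul_sum,
        Fintype.sum_prod_type, Fintype.sum_bool, hU, hD, List.range'_succ, List.map_cons]
      cases h <;> simp only [ih, pathSum, Finset.sum_empty] <;> ring
    · intro a _ b _ hab
      rw [Function.onFun, Finset.disjoint_left]
      intro w h1 h2
      obtain ⟨_, _, rfl⟩ := Finset.mem_image.mp h1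
      obtain ⟨_, _, h3⟩ := Finset.mem_image.mp h2
      exact hab (List.cons.inj h3).1.symm

/-! ### Vertices and their types -/

theorem mem_postorderForest {x : List ℕ} {k : ℕ} {ts : List PlaneTree} :
    x ∈ postorderForest k ts ↔ ∃ m v t, x = (k + m) :: v ∧ ts[m]? = some t ∧ v ∈ postorder t := by
  induction ts generalizing k with
  | nil => simp [postorderForest]
  | cons t ts ih =>
    rw [postorderForest, List.mem_append, List.mem_map, ih]
    constructor
    · rintro (⟨v, hv, rfl⟩ | ⟨m, v, t', rfl, h1, h2⟩)
      · exact ⟨0, v, t, rfl, rfl, hv⟩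
      · exact ⟨m + 1, v, t', by rw [← add_assoc, add_right_comm], h1, h2⟩
    · rintro ⟨_ | m, v, t', rfl, h1, h2⟩
      · left
        cases h1
        exact ⟨v, h2, rfl⟩
      · right
        exact ⟨m, v, t', by rw [← add_assoc, add_right_comm], h1, h2⟩

theorem cons_mem_postorder {k : ℕ} {v : List ℕ} {ts : List PlaneTree} :
    k :: v ∈ postorder (node ts) ↔ ∃ t, ts[k]? = some t ∧ v ∈ postorder t := by
  rw [postorder, List.mem_append, mem_postorderForest]
  constructor
  · rintro (⟨m, v', t, h, h1, h2⟩ | h)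
    · rw [zero_add] at h
      cases h
      exact ⟨t, h1, h2⟩
    · simp at h
  · rintro ⟨t, h1, h2⟩
    exact Or.inl ⟨k, v, t, by rw [zero_add], h1, h2⟩

theorem nil_mem_postorder (T : PlaneTree) : [] ∈ postorder T := by
  cases T with | node ts => simp [postorder]

theorem nil_notMem_postorderForest (k : ℕ) (ts : List PlaneTree) :
    [] ∉ postorderForest k ts := by
  rw [mem_postorderForest]
  simp

theorem zero_mem_postorder {ts : List PlaneTree} : [0] ∈ postorder (node ts) ↔ ts ≠ [] := by
  rw [cons_mem_postorder]
  cases ts with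
  | nil => simp
  | cons t ts => simp [nil_mem_postorder]

theorem nodup_postorderForest (ts : List PlaneTree) (k : ℕ) : (postorderForest k ts).Nodup := by
  induction ts using forest_induction generalizing k with
  | nil => simp [postorderForest]
  | cons cs ts h1 h2 =>
    rw [postorderForest, List.nodup_append']
    refine ⟨List.Nodup.map List.cons_injective ?_, h2 _, ?_⟩
    · rw [postorder, List.nodup_append']
      exact ⟨h1 0, List.nodup_singleton _, by simpa using nil_notMem_postorderForest 0 cs⟩
    · intro x hx hx'
      obtain ⟨v, _, rfl⟩ := List.mem_map.mp hx
      obtain ⟨m, v', t, h, _⟩ := mem_postorderForest.mp hx'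
      have := (List.cons.inj h).1
      omega

theorem nodup_postorder (T : PlaneTree) : T.postorder.Nodup := by
  cases T with | node ts =>
  rw [postorder, List.nodup_append']
  exact ⟨nodup_postorderForest _ _, List.nodup_singleton _,
    by simpa using nil_notMem_postorderForest 0 ts⟩

/-- Whether a vertex is a leaf, and whether it is a leftmost child. -/
def letter (T : PlaneTree) (v : List ℕ) : Bool × Bool :=
  (decide (v ++ [0] ∉ T.postorder), decide (v.getLast? = some 0))

theorem letter_cons {ts cs : List PlaneTree} {k : ℕ} (hk : ts[k]? = some (node cs)) (v : List ℕ) :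
    letter (node ts) (k :: v) =
      if v = [] then (cs.isEmpty, decide (k = 0)) else letter (node cs) v := by
  have h : ∀ u, k :: u ∈ postorder (node ts) ↔ u ∈ postorder (node cs) := by
    intro u
    rw [cons_mem_postorder, hk]
    simp
  unfold letter
  rw [List.cons_append]
  simp only [h]
  split_ifs with hv
  · subst hv
    simp only [List.nil_append, zero_mem_postorder]
    cases cs <;> simp
  · rw [List.getLast?_cons]
    cases hl : v.getLast? with
    | none => exact absurd (List.getLast?_eq_none_iff.mp hl) hv
    | some a => simp

/-- Links the address-based notions of leaf and leftmost child to the recursive word; the root, last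
in postorder, is left out. -/
theorem map_letter (ts : List PlaneTree) :
    (postorderForest 0 ts).map (letter (node ts)) = forestWord true ts := by
  induction ts using children_induction with
  | h ts ih =>
    have key : ∀ (us : List PlaneTree) (k : ℕ), (∀ m t, us[m]? = some t → ts[k + m]? = some t) →
        (postorderForest k us).map (letter (node ts)) = forestWord (decide (k = 0)) us := by
      intro us
      induction us with
      | nil => intros; simp [postorderForest, forestWord]
      | cons t us ih' =>
        intro k hk
        cases t with | node cs =>
        have hcs : ts[k]? = some (node cs) := hk 0 _ rfl
        rw [postorderForest, List.map_append, List.map_map, forestWord,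
          ih' (k + 1) (fun m t h => by rw [add_assoc, add_comm 1]; exact hk (m + 1) t h),
          postorder, List.map_append, ← ih cs (List.mem_of_getElem? hcs)]
        have h1 : (postorderForest 0 cs).map (letter (node ts) ∘ fun v => k :: v) =
            (postorderForest 0 cs).map (letter (node cs)) := by
          refine List.map_congr_left fun v hv => ?_
          rw [Function.comp_apply, letter_cons hcs, if_neg]
          rintro rfl
          exact nil_notMem_postorderForest _ _ hv
        rw [h1]
        simp [letter_cons hcs]
    simpa using key ts 0 (by simp)

theorem card_vertices (ts : List PlaneTree) :
    (node ts).vertices.card = (forestWord true ts).length + 1 := by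
  rw [vertices, List.toFinset_card_of_nodup (nodup_postorder _), ← map_letter, postorder]
  simp

theorem prod_vertices {M : Type*} [CommMonoid M] (f : ℕ → Bool × Bool → M)
    (ts : List PlaneTree) :
    (∏ v ∈ (node ts).vertices, if v = [] then 1 else f ((node ts).label v) (letter (node ts) v)) =
      posProd f 1 (forestWord true ts) := by
  have := prod_toFinset_idxOf (fun k v => if v = [] then 1 else f k (letter (node ts) v)) 1
    (nodup_postorder (node ts))
  rw [← map_letter, posProd_map]
  refine this.trans ?_
  rw [postorder, posProd_append]
  simp only [posProd, if_true, mul_one]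
  refine posProd_congr fun k v hv => if_neg ?_
  rintro rfl
  exact nil_notMem_postorderForest _ _ hv

theorem label_lt {T : PlaneTree} {v : List ℕ} (hv : v ∈ T.vertices) (hne : v ≠ []) :
    T.label v < T.vertices.card := by
  cases T with | node ts =>
  rw [card_vertices, ← map_letter, List.length_map, label]
  have hv' : v ∈ postorderForest 0 ts := by
    simpa [vertices, postorder, hne] using hv
  rw [postorder, List.idxOf_append_of_mem hv']
  have := List.idxOf_lt_length_of_mem hv'
  omega

/-- The weight of a vertex with a given label in the generating function of `squareCount`. -/
noncomputable def squareWeight (d i j p : ℕ) (a : Bool × Bool) : ℤ[X] :=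
  if a = (true, true) ∨ (a = (true, false) ∧ (p ≤ i ∨ d - j ≤ p)) ∨ (a = (false, true) ∧ d - j ≤ p)
  then X else 1

theorem X_pow_card_filter (s : Finset (List ℕ)) (P : List ℕ → Prop) [DecidablePred P] :
    (X : ℤ[X]) ^ (s.filter P).card = ∏ v ∈ s, if P v then X else 1 := by
  rw [Finset.prod_ite, Finset.prod_const, Finset.prod_const_one, mul_one]

theorem X_pow_squareCount (d i j : ℕ) (ts : List PlaneTree) :
    (X : ℤ[X]) ^ squareCount d i j (node ts) =
      posProd (squareWeight d i j) 1 (forestWord true ts) := by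
  rw [squareCount, X_pow_card_filter, ← prod_vertices]
  refine Finset.prod_congr rfl fun v hv => ?_
  unfold squareWeight
  by_cases hne : v = []
  · subst hne
    simp
  · rw [if_neg hne]
    refine if_congr ?_ rfl rfl
    have hv' : v ∈ (node ts).postorder := List.mem_toFinset.mp hv
    simp only [letter, Prod.mk.injEq, decide_eq_true_eq, decide_eq_false_iff_not, Square0, Square1,
      Square2, IsLeaf, IsFirstChild, IsLaterChild, vertices, List.mem_toFinset, hv', true_and,
      hne, ne_eq, not_false_eq_true]

theorem eq_zero_of_isFirstChild {T : PlaneTree} {v : List ℕ} (h1 : T.IsFirstChild v)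
    (h2 : T.IsRootChild v) : v = [0] := by
  obtain ⟨k, rfl⟩ := List.length_eq_one_iff.mp h2.2
  simpa using h1.2

theorem label_eq_one {T : PlaneTree} (h : T.IsLeaf [0]) : T.label [0] = 1 := by
  obtain ⟨h1, h2⟩ := h
  rw [vertices, List.mem_toFinset] at h1 h2
  cases T with | node ts =>
  rcases ts with _ | ⟨⟨cs⟩, ts⟩
  · exact absurd h1 (by simp [postorder, postorderForest])
  · rw [List.cons_append, cons_mem_postorder] at h2
    rcases cs with _ | ⟨c, cs⟩
    · simp [label, postorder, postorderForest]
    · exact absurd ⟨_, rfl, zero_mem_postorder.mpr (List.cons_ne_nil _ _)⟩ h2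

/-- The definitions differ only for a leaf that is the leftmost child of the root. Its label is 1,
at most i, so both counts include it. -/
theorem roundCount_eq_squareCount (d i j : ℕ) (hi : 0 < i) (T : PlaneTree) :
    roundCount d i j T = squareCount d i j T := by
  unfold roundCount squareCount
  congr 1
  refine Finset.filter_congr fun v hv => ?_
  by_cases h : T.IsLeaf v ∧ T.IsFirstChild v ∧ T.IsRootChild v
  · obtain ⟨h1, h2, h3⟩ := h
    have hl : T.label v ≤ i := by
      obtain rfl := eq_zero_of_isFirstChild h2 h3
      rw [label_eq_one h1]
      exact hi
    exact iff_of_true (Or.inr (Or.inl ⟨⟨h1, Or.inl ⟨h2, h3⟩⟩, Or.inl hl⟩)) (Or.inl ⟨h1, h2⟩)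
  · unfold Round0 Round1 Round2 Square0 Square1 Square2
    generalize T.IsLeaf v = A at *
    generalize T.IsFirstChild v = B at *
    generalize T.IsRootChild v = C at *
    by_cases A <;> by_cases B <;> by_cases C <;> simp_all

end PlaneTree

-- Reversal of coefficients

section Reflection

theorem coeff_one_sub_X_pow {k m : ℕ} (hm : m ≤ k) :
    ((1 - X : ℤ[X]) ^ k).coeff (k - m) = ((X - 1 : ℤ[X]) ^ k).coeff m := by
  have h : ∀ l, ((X - 1 : ℤ[X]) ^ k).coeff l = (-1) ^ (k - l) * (k.choose l : ℤ) := by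
    intro l
    have := coeff_X_add_C_pow (-1 : ℤ) k l
    rwa [C_neg, C_1, ← sub_eq_add_neg] at this
  have e : (1 - X : ℤ[X]) ^ k = C ((-1) ^ k) * (X - 1) ^ k := by
    rw [C_pow, ← mul_pow]
    congr 1
    simp
  rw [e, coeff_C_mul, h, h, Nat.choose_symm hm, ← mul_assoc, ← pow_add, Nat.sub_sub_self hm]
  congr 1
  have : k + m = (k - m) + 2 * m := by omega
  rw [this, pow_add, pow_mul]
  simp

theorem natDegree_linear_pow_le {p : ℤ[X]} (hp : p.natDegree ≤ 1) (k : ℕ) :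
    (p ^ k).natDegree ≤ k := by
  simpa using natDegree_pow_le_of_le k hp

/-- Termwise: reversing (1-X)^k X^(n+1-k) in degree n + 1 gives (X-1)^k. -/
theorem coeff_shellSum_reflect {n m : ℕ} (i j : ℕ) (hm : m ≤ n + 1) :
    (shellSum (1 - X) X n i j : ℤ[X]).coeff (n + 1 - m) =
      (shellSum (X - 1) 1 n i j : ℤ[X]).coeff m := by
  unfold shellSum
  rw [finsetSum_coeff, finsetSum_coeff]
  refine Finset.sum_congr rfl fun k hk => ?_
  have hk' : k ≤ n := Nat.lt_succ_iff.mp (Finset.mem_range.mp hk)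
  rw [one_pow, mul_one, coeff_mul_natCast, coeff_mul_natCast, mul_assoc, coeff_natCast_mul,
    coeff_natCast_mul, coeff_mul_X_pow']
  congr 2
  split_ifs with h
  · have e : n + 1 - m - (n + 1 - k) = k - m := by omega
    rw [e, coeff_one_sub_X_pow (by omega)]
  · rw [coeff_eq_zero_of_natDegree_lt]
    have h1 : (X - 1 : ℤ[X]).natDegree ≤ 1 := natDegree_X_sub_C_le (1 : ℤ)
    have := natDegree_linear_pow_le h1 k
    omega

theorem coeff_shellSum_of_lt {n m : ℕ} (i j : ℕ) (hm : n + 1 < m) :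
    (shellSum (1 - X) X n i j : ℤ[X]).coeff m = 0 := by
  unfold shellSum
  rw [finsetSum_coeff]
  refine Finset.sum_eq_zero fun k hk => ?_
  have hk' : k ≤ n := Nat.lt_succ_iff.mp (Finset.mem_range.mp hk)
  rw [coeff_mul_natCast, mul_assoc, coeff_natCast_mul, coeff_mul_X_pow', if_pos (by omega),
    coeff_eq_zero_of_natDegree_lt, mul_zero, zero_mul]
  have h1 : (1 - X : ℤ[X]).natDegree ≤ 1 := by
    refine (natDegree_sub_le _ _).trans ?_
    simp
  have := natDegree_linear_pow_le h1 k
  omega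

end Reflection

-- Generating functions of the tree counts

namespace PlaneTree

theorem finite_card_vertices (d : ℕ) : {T : PlaneTree | T.vertices.card = d}.Finite := by
  refine Set.Finite.of_finite_image (f := fun T => match T with | node ts => forestWord true ts)
    ((List.finite_length_eq (Bool × Bool) (d - 1)).subset ?_) ?_
  · rintro _ ⟨⟨ts⟩, hT, rfl⟩
    have : (node ts).vertices.card = d := hT
    rw [card_vertices] at this
    exact Nat.eq_sub_of_add_eq this
  · rintro ⟨ts⟩ _ ⟨ts'⟩ _ h
    rw [forestWord_true_injective h]

/-- The plane trees with `d` vertices. -/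
noncomputable def treesOfCard (d : ℕ) : Finset PlaneTree := (finite_card_vertices d).toFinset

theorem mem_treesOfCard {d : ℕ} {T : PlaneTree} : T ∈ treesOfCard d ↔ T.vertices.card = d := by
  simp [treesOfCard]

theorem coeff_sum_treesOfCard (d m : ℕ) (c : PlaneTree → ℕ) :
    (∑ T ∈ treesOfCard d, (X : ℤ[X]) ^ c T).coeff m =
      (Set.ncard {T : PlaneTree | T.vertices.card = d ∧ c T = m} : ℤ) := by
  classical
  have : {T : PlaneTree | T.vertices.card = d ∧ c T = m} =
      ((treesOfCard d).filter fun T => c T = m : Finset PlaneTree) := by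
    ext T
    simp [mem_treesOfCard]
  rw [this, Set.ncard_coe_finset, finsetSum_coeff, Finset.card_filter]
  push_cast
  refine Finset.sum_congr rfl fun T _ => ?_
  rw [coeff_X_pow]
  simp [eq_comm]

/-- Plane trees with at least two vertices correspond to paths. -/
theorem sum_treesOfCard {M : Type*} [AddCommMonoid M] (n : ℕ) (φ : PlaneTree → M)
    (ψ : List (Bool × Bool) → M) (h : ∀ ts, φ (node ts) = ψ (forestWord true ts)) :
    ∑ T ∈ treesOfCard (n + 2), φ T = ∑ w ∈ paths n 0, ψ ((true, true) :: w) := by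
  have key : ∀ ts, node ts ∈ treesOfCard (n + 2) →
      ∃ w ∈ paths n 0, forestWord true ts = (true, true) :: w := by
    intro ts hts
    rw [mem_treesOfCard, card_vertices] at hts
    have hne : ts ≠ [] := by
      rintro rfl
      simp [forestWord] at hts
    obtain ⟨w, hw, hp⟩ := (isPath_forestWord ts).1 0 [] rfl hne
    rw [List.append_nil] at hw
    refine ⟨w, mem_paths.mpr ⟨hp, ?_⟩, hw⟩
    rw [hw, List.length_cons] at hts
    omega
  refine Finset.sum_bij (fun T _ => match T with | node ts => (forestWord true ts).tail) ?_ ?_ ?_ ?_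
  · rintro ⟨ts⟩ hts
    obtain ⟨w, hw, h⟩ := key ts hts
    simpa [h] using hw
  · rintro ⟨ts⟩ hts ⟨ts'⟩ hts' heq
    obtain ⟨w, _, h1⟩ := key ts hts
    obtain ⟨w', _, h2⟩ := key ts' hts'
    simp only [h1, h2, List.tail_cons] at heq
    subst heq
    rw [forestWord_true_injective (h1.trans h2.symm)]
  · intro w hw
    obtain ⟨hp, hl⟩ := mem_paths.mp hw
    -- The initial stack is the state after the forced first letter, a leaf with label 1.
    obtain ⟨ts, _, hts⟩ := exists_forestWord_eq w 0 hp [[node []]] rfl (by simp)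
    have hts' : forestWord true ts = (true, true) :: w := by
      rw [hts]; simp [stackWord, forestWord]
    refine ⟨node ts, ?_, ?_⟩
    · rw [mem_treesOfCard, card_vertices, hts', List.length_cons, hl]
    · simp [hts']
  · rintro ⟨ts⟩ hts
    obtain ⟨w, _, h1⟩ := key ts hts
    simp only [h, h1, List.tail_cons]

theorem sum_squareCount_eq_pathSum (n i j : ℕ) :
    ∑ T ∈ treesOfCard (n + 2), (X : ℤ[X]) ^ squareCount (n + 2) i j T =
      X * pathSum X 0 ((List.range' 2 n).map fun k =>
        squareWeight (n + 2) i j k (true, false) + squareWeight (n + 2) i j k (false, true)) := by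
  rw [sum_treesOfCard n _ (posProd (squareWeight (n + 2) i j) 1) (X_pow_squareCount _ _ _)]
  rw [← sum_paths X (squareWeight (n + 2) i j) (fun _ => by simp [squareWeight])
    (fun _ => by simp [squareWeight]), Finset.mul_sum]
  refine Finset.sum_congr rfl fun w _ => ?_
  simp [posProd, squareWeight]

theorem sum_squareCount_eq_umbral (n i j : ℕ) (u : ℕ → ℤ[X])
    (hu : ∀ k ∈ List.range' 2 n, squareWeight (n + 2) i j k (true, false) +
      squareWeight (n + 2) i j k (false, true) = 2 + u k) :
    ∑ T ∈ treesOfCard (n + 2), (X : ℤ[X]) ^ squareCount (n + 2) i j T =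
      umbral cubeG ((X + C (X - 1)) * ((List.range' 2 n).map fun k => X + C (u k)).prod) := by
  have h := pathSum_eq_umbral (X - 1 : ℤ[X]) ((List.range' 2 n).map u)
  rw [add_sub_cancel, List.map_map, List.map_map] at h
  rw [sum_squareCount_eq_pathSum, List.map_congr_left hu]
  exact h

/-- The generating function of `squareCount`. -/
theorem sum_squareCount (n i j : ℕ) (hi : 0 < i) (hij : i + j ≤ n + 1) :
    ∑ T ∈ treesOfCard (n + 2), (X : ℤ[X]) ^ squareCount (n + 2) i j T =
      shellSum (X - 1) 1 (n + 1) i j := by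
  obtain ⟨i, rfl⟩ := Nat.exists_eq_add_one.mpr hi
  obtain ⟨m, rfl⟩ : ∃ m, n = i + m + j := ⟨n - i - j, by omega⟩
  -- Excess of the level weight over 2: for small labels only the leaf step gains x-1, for large
  -- labels both level steps do.
  set u : ℕ → ℤ[X] := fun k => if k ≤ i + 1 then X - 1 else
    if i + m + 2 ≤ k then 2 * (X - 1) else 0 with hu
  have hw : ∀ k ∈ List.range' 2 (i + m + j), squareWeight (i + m + j + 2) (i + 1) j k (true, false) +
      squareWeight (i + m + j + 2) (i + 1) j k (false, true) = 2 + u k := by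
    intro k hk
    have := List.mem_range'_1.mp hk
    have e : i + m + j + 2 - j = i + m + 2 := by omega
    simp only [squareWeight, e, hu]
    by_cases h1 : k ≤ i + 1
    · have h2 : ¬ i + m + 2 ≤ k := by omega
      simp only [h1, h2, and_true, and_false, or_true, or_false, if_true, if_false,
        Prod.mk.injEq, reduceCtorEq]
      ring
    · by_cases h2 : i + m + 2 ≤ k
      · simp only [h1, h2, and_true, or_true, true_or, if_true, if_false]
        ring
      · simp only [h1, h2, and_false, or_false, if_false, Prod.mk.injEq, reduceCtorEq]
        norm_num
  have hrange : List.range' 2 (i + m + j) =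
      List.range' 2 i ++ (List.range' (2 + i) m ++ List.range' (2 + i + m) j) := by
    rw [List.range'_append_1, List.range'_append_1, add_assoc]
  have hconst : ∀ (l : List ℕ) (c : ℤ[X]), (∀ k ∈ l, u k = c) →
      (l.map fun k => X + C (u k)).prod = (X + C c) ^ l.length := by
    intro l c h
    rw [List.map_congr_left fun k hk => by rw [h k hk], List.map_const', List.prod_replicate]
  -- The labels 2, …, i+1 give only i factors X + (x-1); the missing one is the prefactor in
  -- `sum_squareCount_eq_umbral`.
  have h2 := linearMap_eq_shellSum (umbral cubeG) (X - 1) 1 0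
    (fun n => by rw [C_0, add_zero, umbral_X_pow]; rfl) (i + 1) j m
  have e : m + (i + 1) + j = i + m + j + 1 := by omega
  rw [e, zero_add, zero_add] at h2
  rw [sum_squareCount_eq_umbral _ _ _ u hw, hrange, List.map_append, List.map_append,
    List.prod_append, List.prod_append, hconst (List.range' 2 i) (X - 1),
    hconst (List.range' (2 + i) m) 0, hconst (List.range' (2 + i + m) j) (2 * (X - 1)), ← h2]
  · refine congrArg (umbral cubeG) ?_
    simp only [List.length_range']
    generalize (X + C (X - 1) : ℤ[X][X]) = P
    generalize (X + C (2 * (X - 1)) : ℤ[X][X]) = Q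
    rw [pow_succ]
    ac_rfl
  · intro k hk
    have := List.mem_range'_1.mp hk
    simp only [hu]
    rw [if_neg (by omega), if_pos (by omega)]
  · intro k hk
    have := List.mem_range'_1.mp hk
    simp only [hu]
    rw [if_neg (by omega), if_neg (by omega)]
  · intro k hk
    have := List.mem_range'_1.mp hk
    simp only [hu]
    rw [if_pos (by omega)]

/-! ### The generating function of `roundCount` for `i = j = 0` -/

theorem X_pow_card_square0 (ts : List PlaneTree) :
    (X : ℤ[X]) ^ ((node ts).vertices.filter (node ts).Square0).card =
      X ^ (forestWord true ts).count (true, true) := by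
  have h : ∀ p (w : List (Bool × Bool)),
      posProd (fun _ a => if a = (true, true) then (X : ℤ[X]) else 1) p w =
        X ^ w.count (true, true) := by
    intro p w
    induction w generalizing p with
    | nil => simp [posProd]
    | cons a w ih =>
      rw [posProd, ih, List.count_cons]
      by_cases ha : a = (true, true)
      · simp [ha, pow_succ']
      · simp [ha]
  rw [X_pow_card_filter, ← h 1, ← prod_vertices]
  refine Finset.prod_congr rfl fun v hv => ?_
  have hv' : v ∈ (node ts).postorder := List.mem_toFinset.mp hv
  by_cases hne : v = []
  · subst hne
    simp
  · rw [if_neg hne]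
    refine if_congr ?_ rfl rfl
    simp only [letter, Prod.mk.injEq, decide_eq_true_eq, Square0, IsLeaf, IsFirstChild, vertices,
      List.mem_toFinset, hv', true_and]

/-- Labels start with 1, and only the root has label d; the root is neither a first nor a later
child. -/
theorem squareCount_zero_zero (T : PlaneTree) (d : ℕ) (hd : T.vertices.card = d) :
    squareCount d 0 0 T = (T.vertices.filter T.Square0).card := by
  unfold squareCount
  congr 1
  refine Finset.filter_congr fun v hv => ?_
  constructor
  · rintro (h | ⟨h1, h2 | h2⟩ | ⟨h1, h2⟩)
    · exact h
    · simp [label] at h2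
    · have := label_lt hv h1.2.2.1
      omega
    · have := label_lt hv (by rintro rfl; simpa using h1.2.2)
      omega
  · exact Or.inl

theorem roundCount_zero_zero (T : PlaneTree) (d : ℕ) (hd : T.vertices.card = d) :
    roundCount d 0 0 T = (T.vertices.filter T.Round0).card := by
  unfold roundCount
  congr 1
  refine Finset.filter_congr fun v hv => ?_
  constructor
  · rintro (h | ⟨h1, h2 | h2⟩ | ⟨h1, h2⟩)
    · exact h
    · simp [label] at h2
    · have := label_lt hv (by
        rintro rfl
        rcases h1.2 with h | h
        · simpa using h.1.2
        · exact h.2.1 rfl)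
      omega
    · have := label_lt hv (by rintro rfl; simpa using h1.2.2)
      omega
  · exact Or.inl

theorem card_square0 (T : PlaneTree) [Decidable (T.IsLeaf [0])] :
    (T.vertices.filter T.Square0).card =
      (T.vertices.filter T.Round0).card + if T.IsLeaf [0] then 1 else 0 := by
  have h0 : T.IsLeaf [0] → T.IsFirstChild [0] ∧ T.IsRootChild [0] :=
    fun h => ⟨⟨h.1, rfl⟩, h.1, rfl⟩
  split_ifs with h
  · have : T.vertices.filter T.Square0 = insert [0] (T.vertices.filter T.Round0) := by
      ext v
      simp only [Finset.mem_filter, Finset.mem_insert]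
      constructor
      · rintro ⟨hv, h1, h2⟩
        by_cases h3 : T.IsRootChild v
        · exact Or.inl (eq_zero_of_isFirstChild h2 h3)
        · exact Or.inr ⟨hv, h1, h2, h3⟩
      · rintro (rfl | ⟨hv, h1, h2, _⟩)
        · exact ⟨h.1, h, (h0 h).1⟩
        · exact ⟨hv, h1, h2⟩
    rw [this, Finset.card_insert_of_notMem]
    intro h'
    exact (Finset.mem_filter.mp h').2.2.2 (h0 h).2
  · rw [add_zero]
    congr 1
    refine Finset.filter_congr fun v hv => ⟨fun ⟨h1, h2⟩ => ⟨h1, h2, fun h3 => ?_⟩,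
      fun ⟨h1, h2, _⟩ => ⟨h1, h2⟩⟩
    obtain rfl := eq_zero_of_isFirstChild h2 h3
    exact h h1

theorem isLeaf_zero_iff (ts : List PlaneTree) :
    (node ts).IsLeaf [0] ↔ ∃ us, ts = node [] :: us := by
  simp only [IsLeaf, vertices, List.mem_toFinset, List.cons_append,
    List.nil_append, cons_mem_postorder]
  rcases ts with _ | ⟨⟨_ | ⟨c, cs⟩⟩, us⟩
  · simp
  · simp [zero_mem_postorder, nil_mem_postorder]
  · simp [zero_mem_postorder]

theorem X_pow_card_round0 (ts : List PlaneTree) :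
    (X : ℤ[X]) ^ ((node ts).vertices.filter (node ts).Round0).card =
      X ^ (forestWord false ts).count (true, true) := by
  classical
  have h := X_pow_card_square0 ts
  rw [card_square0] at h
  rcases ts with _ | ⟨⟨_ | ⟨c, cs⟩⟩, us⟩
  · rw [if_neg (by simp [isLeaf_zero_iff]), add_zero] at h
    rw [h]
    simp [forestWord]
  · rw [if_pos ((isLeaf_zero_iff _).mpr ⟨us, rfl⟩), pow_succ] at h
    refine mul_right_cancel₀ (X_ne_zero (R := ℤ)) (h.trans ?_)
    simp [forestWord, pow_succ]
  · rw [if_neg (by simp [isLeaf_zero_iff]), add_zero] at h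
    rw [h]
    simp [forestWord]

/-- The generating function of the vertices of type `(0)`. -/
noncomputable def roundPoly (d : ℕ) : ℤ[X] :=
  ∑ T ∈ treesOfCard d, (X : ℤ[X]) ^ (T.vertices.filter T.Round0).card

theorem roundPoly_one : roundPoly 1 = 1 := by
  have : treesOfCard 1 = {node []} := by
    ext ⟨ts⟩
    rw [mem_treesOfCard, card_vertices, Finset.mem_singleton]
    constructor
    · intro h
      have h' : forestWord true ts = [] := List.length_eq_zero_iff.mp (by omega)
      rw [forestWord_true_injective (h'.trans (by simp [forestWord] : [] = forestWord true []))]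
    · intro h
      cases h
      simp [forestWord]
  rw [roundPoly, this, Finset.sum_singleton, X_pow_card_round0]
  simp [forestWord]

theorem length_forestWord (b b' : Bool) (ts : List PlaneTree) :
    (forestWord b ts).length = (forestWord b' ts).length := by
  rcases ts with _ | ⟨⟨cs⟩, ts⟩ <;> simp [forestWord]

/-- The two statistics differ by one exactly on trees whose first root child is a leaf. Deleting
that leaf is a bijection onto trees with one vertex fewer and preserves the number of vertices of
type (0). -/
theorem sum_square0_eq (d : ℕ) :
    ∑ T ∈ treesOfCard (d + 1), (X : ℤ[X]) ^ (T.vertices.filter T.Square0).card =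
      roundPoly (d + 1) + (X - 1) * roundPoly d := by
  classical
  have h1 : ∀ T ∈ treesOfCard (d + 1), (X : ℤ[X]) ^ (T.vertices.filter T.Square0).card =
      X ^ (T.vertices.filter T.Round0).card +
      if T.IsLeaf [0] then (X - 1) * X ^ (T.vertices.filter T.Round0).card else 0 := by
    intro T _
    rw [card_square0]
    split_ifs
    · ring
    · rw [add_zero, add_zero]
  rw [Finset.sum_congr rfl h1, Finset.sum_add_distrib, ← Finset.sum_filter, ← Finset.mul_sum]
  congr 2
  symm
  refine Finset.sum_bij (fun T _ => match T with | node ts => node (node [] :: ts)) ?_ ?_ ?_ ?_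
  · rintro ⟨ts⟩ hts
    rw [mem_treesOfCard, card_vertices] at hts
    rw [Finset.mem_filter, mem_treesOfCard, card_vertices, isLeaf_zero_iff]
    refine ⟨?_, ts, rfl⟩
    rw [← hts, length_forestWord true false ts]
    simp [forestWord]
  · rintro ⟨ts⟩ _ ⟨ts'⟩ _ h
    simpa using h
  · rintro ⟨ts⟩ hT
    obtain ⟨h1, h2⟩ := Finset.mem_filter.mp hT
    obtain ⟨us, rfl⟩ := (isLeaf_zero_iff _).mp h2
    refine ⟨node us, ?_, rfl⟩
    rw [mem_treesOfCard, card_vertices] at h1 ⊢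
    rw [length_forestWord true false us]
    simpa [forestWord] using h1
  · rintro ⟨ts⟩ _
    rw [X_pow_card_round0, X_pow_card_round0]
    simp [forestWord]

/-- The path count gives the left side of `sum_square0_eq` as Λ((X+(x-1))X^n) = g_{n+1} + (x-1)g_n.
This is the recursion satisfied by `roundPoly`, so induction cancels the second term. -/
theorem roundPoly_succ (n : ℕ) : roundPoly (n + 1) = cubeG n := by
  induction n with
  | zero =>
    rw [roundPoly_one]
    simp [cubeG, shellSum, shellCoeff]
  | succ n ih =>
    have h1 := sum_square0_eq (n + 1)
    have h2 := sum_squareCount_eq_umbral n 0 0 (fun _ => 0) fun k hk => by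
      have := List.mem_range'_1.mp hk
      have h0 : ¬ k = 0 := by omega
      have h3 : ¬ n + 2 ≤ k := by omega
      simp [squareWeight, h0, h3]
      norm_num
    rw [Finset.sum_congr rfl fun T hT => by
      rw [squareCount_zero_zero T _ (mem_treesOfCard.mp hT)]] at h2
    rw [h2, ih] at h1
    simp only [C_0, add_zero, List.map_const', List.length_range', List.prod_replicate] at h1
    rw [add_mul, ← pow_succ', ← smul_eq_C_mul, map_add, map_smul, umbral_X_pow, umbral_X_pow,
      smul_eq_mul] at h1
    exact (add_right_cancel h1).symm

/-- The generating function of `roundCount`. -/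
theorem sum_roundCount (n i j : ℕ) (hij : i + j ≤ n + 1) (h0 : i = 0 → j = 0) :
    ∑ T ∈ treesOfCard (n + 2), (X : ℤ[X]) ^ roundCount (n + 2) i j T =
      shellSum (X - 1) 1 (n + 1) i j := by
  rcases Nat.eq_zero_or_pos i with rfl | hi
  · obtain rfl := h0 rfl
    have := roundPoly_succ (n + 1)
    rw [cubeG, roundPoly] at this
    rw [← this]
    exact Finset.sum_congr rfl fun T hT => by
      rw [roundCount_zero_zero T _ (mem_treesOfCard.mp hT)]
  · rw [← sum_squareCount n i j hi hij]
    exact Finset.sum_congr rfl fun T _ => by rw [roundCount_eq_squareCount _ _ _ hi]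

end PlaneTree

theorem mainTheorem2 {V : Type*} [DecidableEq V] (K : CubicalComplex V) (d r : ℕ)
    (F : Fin r → Finset V) (hF : K.IsShelling d F) (t : Fin r) (i j : ℕ)
    (ht : K.HasType d F t i j) (hj : j < d - 1) :
    K.contribution F t = shellPoly d i j ∧
    (∀ m ≤ d, (K.contribution F t).coeff (d - m) =
      (Set.ncard {T : PlaneTree | T.vertices.card = d ∧ T.roundCount d i j = m} : ℤ)) ∧
    (0 < i → ∀ m ≤ d, (K.contribution F t).coeff (d - m) =
      (Set.ncard {T : PlaneTree | T.vertices.card = d ∧ T.squareCount d i j = m} : ℤ)) ∧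
    (∀ n, 0 ≤ (K.contribution F t).coeff n) := by
  obtain ⟨hij, h0, hc⟩ := hF.contribution_eq_shellPoly t ht hj
  -- From j < d - 1 one has d ≥ 2, so every tree has a non-root vertex and its word begins with an
  -- up step.
  obtain ⟨n, rfl⟩ : ∃ n, d = n + 2 := ⟨d - 2, by omega⟩
  have hround : ∀ m ≤ n + 2, (K.contribution F t).coeff (n + 2 - m) =
      (Set.ncard {T : PlaneTree | T.vertices.card = n + 2 ∧ T.roundCount (n + 2) i j = m} : ℤ) := by
    intro m hm
    rw [hc, shellPoly_succ, coeff_shellSum_reflect i j hm, ← PlaneTree.sum_roundCount n i j hij h0,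
      PlaneTree.coeff_sum_treesOfCard]
  refine ⟨hc, hround, fun hi m hm => ?_, fun m => ?_⟩
  · rw [hc, shellPoly_succ, coeff_shellSum_reflect i j hm,
      ← PlaneTree.sum_squareCount n i j hi hij, PlaneTree.coeff_sum_treesOfCard]
  · rcases Nat.lt_or_ge (n + 2) m with h | h
    · rw [hc, shellPoly_succ, coeff_shellSum_of_lt i j h]
    · have := hround (n + 2 - m) (by omega)
      rw [Nat.sub_sub_self h] at this
      rw [this]
      positivity
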